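/- **Theorem (Achievability with exponentially small error).** All logarithms are to base $2$. For each $n\in\mathbb N$ let $\rho_1^n,\sigma_1^n$ be quantum states (density matrices) on $\mathbb C^{d_1^n}$ and $\rho_2^n,\sigma_2^n$ quantum states on $\mathbb C^{d_2^n}$, with arbitrary dimensions $d_1^n,d_2^n$, where $\sigma_1^n$ and $\sigma_2^n$ have full support. For states $\rho,\sigma$ with $\sigma$ of full support let $$\tilde D_\alpha(\rho\|\sigma)=\frac1{\alpha-1}\log\operatorname{tr}\Big(\sigma^{\frac{1-\alpha}{2\alpha}}\rho\,\sigma^{\frac{1-\alpha}{2\alpha}}\Big)^{\alpha}\quad(\alpha\neq1),\qquad \tilde D_1(\rho\|\sigma)=D(\rho\|\sigma)=\operatorname{tr}\rho(\log\rho-\log\sigma)$$ be the sandwiched Rényi divergence of order $\alpha$ and the relative entropy. Assume that for $i\in\{1,2\}$ the limits $$\tilde D_\alpha(\vec\rho_i\|\vec\sigma_i):=\lim_{n\to\infty}\frac1n\tilde D_\alpha(\rho_i^n\|\sigma_i^n)$$ exist (in the extended reals $[-\infty,+\infty]$) for all $\alpha$ in a neighbourhood of $1$, including $\alpha=1$,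 and are continuous in $\alpha$ at $\alpha=1$. Write $D(\vec\rho_i\|\vec\sigma_i):=\tilde D_1(\vec\rho_i\|\vec\sigma_i)$ and assume $$D(\vec\rho_1\|\vec\sigma_1)>D(\vec\rho_2\|\vec\sigma_2).$$ Then there exist $\gamma>0$, $n_0\in\mathbb N$ and a sequence $\{\mathcal E_n\}_{n\in\mathbb N}$ of quantum channels (completely positive trace-preserving linear maps) from $d_1^n\times d_1^n$ to $d_2^n\times d_2^n$ matrices, each of the test-and-prepare form $\mathcal E_n(X)=\operatorname{tr}(EX)\,\tau_1+\operatorname{tr}((\mathbb 1-E)X)\,\tau_2$ with $\tau_1,\tau_2$ states and $0\le E\le\mathbb 1$ (all depending on $n$), such that $$\mathcal E_n(\sigma_1^n)=\sigma_2^n\quad\forall n\in\mathbb N\qquad\text{and}\qquad \Delta\big(\mathcal E_n(\rho_1^n),\rho_2^n\big)\le2^{-\gamma n}\quad\forall n\ge n_0,$$ both for the trace distance $\Delta(\rho,\sigma)=T(\rho,\sigma)=\frac12\|\rho-\sigma\|_1$ and for the purified distance $\Delta(\rho,\sigma)=P(\rho,\sigma)=\sqrt{1-\|\sqrt\rho\sqrt\sigma\|_1^2}$.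 -/

import Mathlib

open Filter Topology
open scoped MatrixOrder ComplexOrder

namespace QDichotomy

/-- `ρ` is a quantum state (density matrix) on `ℂ^d`. -/
def IsState {d : ℕ} (ρ : Matrix (Fin d) (Fin d) ℂ) : Prop :=
  ρ.PosSemidef ∧ ρ.trace = 1

/-- The Schatten 1-norm `tr √(Aᴴ A)`. -/
noncomputable def schattenOneNorm {d : ℕ} (A : Matrix (Fin d) (Fin d) ℂ) : ℝ :=
  (CFC.sqrt (A.conjTranspose * A)).trace.re

/-- The trace distance `T(ρ, σ) = ½ ‖ρ - σ‖₁`. -/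
noncomputable def traceDistance {d : ℕ} (ρ σ : Matrix (Fin d) (Fin d) ℂ) : ℝ :=
  schattenOneNorm (ρ - σ) / 2

/-- The (squared) fidelity `F(ρ, σ) = ‖√ρ √σ‖₁²`. -/
noncomputable def fidelity {d : ℕ} (ρ σ : Matrix (Fin d) (Fin d) ℂ) : ℝ :=
  schattenOneNorm (CFC.sqrt ρ * CFC.sqrt σ) ^ 2

/-- The purified distance `P(ρ, σ) = √(1 - F(ρ, σ))`. -/
noncomputable def purifiedDistance {d : ℕ} (ρ σ : Matrix (Fin d) (Fin d) ℂ) : ℝ :=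
  Real.sqrt (1 - fidelity ρ σ)

/-- The relative entropy `D(ρ‖σ) = tr ρ (log₂ ρ - log₂ σ)`, for `σ` of full support. The convention
`Real.logb 2 0 = 0` on the kernel of `ρ` is the usual `0 log 0 = 0`. -/
noncomputable def relativeEntropy {d : ℕ} (ρ σ : Matrix (Fin d) (Fin d) ℂ) : ℝ :=
  (ρ * (cfc (Real.logb 2) ρ - cfc (Real.logb 2) σ)).trace.re

/-- The sandwiched Rényi divergence of order `α`, for `σ` of full support:
`(α - 1)⁻¹ log₂ tr (σ^((1-α)/(2α)) ρ σ^((1-α)/(2α)))^α` for `α ≠ 1`, and the relative entropy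
(its limit) for `α = 1`. The powers are powers of positive semidefinite matrices. -/
noncomputable def sandwichedRenyi {d : ℕ} (α : ℝ) (ρ σ : Matrix (Fin d) (Fin d) ℂ) : ℝ :=
  if α = 1 then relativeEntropy ρ σ
  else 1 / (α - 1) * Real.logb 2
    ((σ ^ ((1 - α) / (2 * α)) * ρ * σ ^ ((1 - α) / (2 * α))) ^ α).trace.re

/-- The sequence `n ↦ (1/n) D̃_α(ρⁿ‖σⁿ)`, viewed in the extended reals. -/
noncomputable def renyiRate {d : ℕ → ℕ} (ρ σ : (n : ℕ) → Matrix (Fin (d n)) (Fin (d n)) ℂ)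
    (α : ℝ) (n : ℕ) : EReal :=
  ((1 / (n : ℝ) * sandwichedRenyi α (ρ n) (σ n) : ℝ) : EReal)

/-- The regularized divergence `D̃_α(ρ⃗‖σ⃗) = lim (1/n) D̃_α(ρⁿ‖σⁿ)`. At `α = 1` this is
the regularized relative entropy. -/
noncomputable def regularizedRenyi {d : ℕ → ℕ}
    (ρ σ : (n : ℕ) → Matrix (Fin (d n)) (Fin (d n)) ℂ) (α : ℝ) : EReal :=
  limUnder atTop (renyiRate ρ σ α)

/-- The limits defining `D̃_α(ρ⃗‖σ⃗)` exist for all `α` close to `1` (including `α = 1`), and are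
continuous in `α` at `α = 1`. -/
def RegularizedRenyiCondition {d : ℕ → ℕ}
    (ρ σ : (n : ℕ) → Matrix (Fin (d n)) (Fin (d n)) ℂ) : Prop :=
  (∀ᶠ α in 𝓝 (1 : ℝ), ∃ L : EReal, Tendsto (renyiRate ρ σ α) atTop (𝓝 L)) ∧
    ContinuousAt (regularizedRenyi ρ σ) 1

/-- `id_k ⊗ Φ`, applied to a `k × k` block matrix with blocks in `M_d(ℂ)`. -/
def ampliation {d d' : ℕ} (Φ : Matrix (Fin d) (Fin d) ℂ →ₗ[ℂ] Matrix (Fin d') (Fin d') ℂ)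
    (k : ℕ) (M : Matrix (Fin k × Fin d) (Fin k × Fin d) ℂ) :
    Matrix (Fin k × Fin d') (Fin k × Fin d') ℂ :=
  Matrix.of fun p q => Φ (Matrix.of fun i j => M (p.1, i) (q.1, j)) p.2 q.2

/-- Quantum channels: completely positive, trace-preserving linear maps. -/
def IsChannel {d d' : ℕ} (Φ : Matrix (Fin d) (Fin d) ℂ →ₗ[ℂ] Matrix (Fin d') (Fin d') ℂ) : Prop :=
  (∀ (k : ℕ) (M : Matrix (Fin k × Fin d) (Fin k × Fin d) ℂ),
      M.PosSemidef → (ampliation Φ k M).PosSemidef) ∧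
    ∀ X, (Φ X).trace = X.trace

/-- Test-and-prepare maps `X ↦ tr(E X) γ₁ + tr((1 - E) X) γ₂`, with `γ₁, γ₂` states and
`0 ≤ E ≤ 1`. -/
def IsTestAndPrepare {d d' : ℕ}
    (Φ : Matrix (Fin d) (Fin d) ℂ →ₗ[ℂ] Matrix (Fin d') (Fin d') ℂ) : Prop :=
  ∃ (γ₁ γ₂ : Matrix (Fin d') (Fin d') ℂ) (E : Matrix (Fin d) (Fin d) ℂ),
    IsState γ₁ ∧ IsState γ₂ ∧ E.PosSemidef ∧ (1 - E).PosSemidef ∧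
      ∀ X, Φ X = (E * X).trace • γ₁ + ((1 - E) * X).trace • γ₂

end QDichotomy

/-! The channel tests `ρ₁` against `σ₁`, then prepares a state according to the outcome. Choose real
rates u < v < w strictly between the two regularized relative entropies; continuity at 1 keeps the
first pair above w at some order α < 1 and the second pair below u at some order β > 1.

Test: put t = 2^(vn). The projection E onto the positive part of ρ₁ - tσ₁ makes tr (1 - E)ρ₁ + t tr
Eσ₁ exponentially small. This is Audenaert's inequality (`trace_sub_le_trace_rpow_mul_rpow`), whose
right side, a Petz quantity, is bounded by the sandwiched one in
`trace_rpow_mul_rpow_le_sandwiched`.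

Preparation: since v > u, the positive part of ρ₂ - tσ₂ has exponentially small trace
(`exists_posPart_trace_le`, from data processing for a projective measurement). Hence ρ₂ is
exponentially close to a state ω ≤ (t + 1)σ₂ (`exists_smoothing`).

Gluing: with q = tr Eσ₁, prepare ω on acceptance and τ = (σ₂ - qω)/(1 - q) on rejection. Then σ₁
goes to σ₂ exactly, and τ is positive because q(t + 1) ≤ 1. The image of ρ₁ misses ρ₂ by at most the
test error plus the smoothing error (`exists_channel`). -/

namespace QDichotomy

open Matrix

variable {d d' : ℕ}

/-! ### Spectral calculus and real powers of matrices. -/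

/-- The matrix `U diag(l) Uᴴ`. -/
noncomputable def spec (U : Matrix (Fin d) (Fin d) ℂ) (l : Fin d → ℝ) :
    Matrix (Fin d) (Fin d) ℂ :=
  U * diagonal (fun i => (l i : ℂ)) * Uᴴ

theorem spec_mul_spec {U : Matrix (Fin d) (Fin d) ℂ} (hU : Uᴴ * U = 1) (l m : Fin d → ℝ) :
    spec U l * spec U m = spec U (fun i => l i * m i) := by
  have h : spec U l * spec U m =
      U * (diagonal (fun i => (l i : ℂ)) * (Uᴴ * U) * diagonal (fun i => (m i : ℂ))) * Uᴴ := by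
    simp only [spec, Matrix.mul_assoc]
  rw [h, hU, Matrix.mul_one, diagonal_mul_diagonal]
  simp [spec]

theorem spec_sub_spec (U : Matrix (Fin d) (Fin d) ℂ) (l m : Fin d → ℝ) :
    spec U l - spec U m = spec U (fun i => l i - m i) := by
  simp only [spec, ← Matrix.sub_mul, ← Matrix.mul_sub, diagonal_sub]
  simp

theorem spec_one {U : Matrix (Fin d) (Fin d) ℂ} (hU : U * Uᴴ = 1) :
    spec U (fun _ => 1) = 1 := by
  simp [spec, hU]

theorem spec_posSemidef (U : Matrix (Fin d) (Fin d) ℂ) {l : Fin d → ℝ} (hl : ∀ i, 0 ≤ l i) :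
    (spec U l).PosSemidef :=
  (PosSemidef.diagonal (fun i => by simpa using hl i)).mul_mul_conjTranspose_same U

theorem spec_trace {U : Matrix (Fin d) (Fin d) ℂ} (hU : Uᴴ * U = 1) (l : Fin d → ℝ) :
    (spec U l).trace.re = ∑ i, l i := by
  rw [spec, trace_mul_comm, ← Matrix.mul_assoc, hU, Matrix.one_mul, trace_diagonal]
  simp

theorem spec_diag {U : Matrix (Fin d) (Fin d) ℂ} (hU : Uᴴ * U = 1) (l : Fin d → ℝ) :
    Uᴴ * spec U l * U = diagonal (fun i => (l i : ℂ)) := by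
  have h : Uᴴ * spec U l * U = (Uᴴ * U) * diagonal (fun i => (l i : ℂ)) * (Uᴴ * U) := by
    simp only [spec, Matrix.mul_assoc]
  rw [h, hU, Matrix.one_mul, Matrix.mul_one]

theorem spec_pow {U : Matrix (Fin d) (Fin d) ℂ} (hU : Uᴴ * U = 1) (hU' : U * Uᴴ = 1)
    (l : Fin d → ℝ) (k : ℕ) : spec U l ^ k = spec U (fun i => l i ^ k) := by
  induction k with
  | zero => simp [spec_one hU']
  | succ k ih => rw [pow_succ, ih, spec_mul_spec hU]; simp [pow_succ]

theorem exists_spec_cfc {A : Matrix (Fin d) (Fin d) ℂ} (hA : A.IsHermitian) :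
    ∃ (U : Matrix (Fin d) (Fin d) ℂ) (l : Fin d → ℝ), Uᴴ * U = 1 ∧ U * Uᴴ = 1 ∧
      A = spec U l ∧ ∀ f : ℝ → ℝ, cfc f A = spec U (fun i => f (l i)) := by
  have h1 : ∀ f : ℝ → ℝ, cfc f A =
      spec (hA.eigenvectorUnitary : Matrix (Fin d) (Fin d) ℂ) (fun i => f (hA.eigenvalues i)) := by
    intro f
    rw [hA.cfc_eq f, IsHermitian.cfc, Unitary.conjStarAlgAut_apply]
    rfl
  refine ⟨hA.eigenvectorUnitary, hA.eigenvalues, ?_, ?_, ?_, h1⟩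
  · exact Unitary.coe_star_mul_self hA.eigenvectorUnitary
  · exact Unitary.coe_mul_star_self hA.eigenvectorUnitary
  · have := h1 id
    rwa [cfc_id ℝ A hA.isSelfAdjoint] at this

theorem exists_spec_rpow {A : Matrix (Fin d) (Fin d) ℂ} (hA : A.PosSemidef) :
    ∃ (U : Matrix (Fin d) (Fin d) ℂ) (l : Fin d → ℝ), Uᴴ * U = 1 ∧ U * Uᴴ = 1 ∧
      (∀ i, 0 ≤ l i) ∧ A = spec U l ∧ ∀ x : ℝ, A ^ x = spec U (fun i => l i ^ x) := by
  obtain ⟨U, l, h1, h2, h3, h4⟩ := exists_spec_cfc hA.isHermitian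
  refine ⟨U, l, h1, h2, fun i => ?_, h3, fun x => ?_⟩
  · have h := (hA.conjTranspose_mul_mul_same U).diag_nonneg (i := i)
    rw [h3, spec_diag h1] at h
    simpa using h
  · rw [CFC.rpow_eq_cfc_real (nonneg_iff_posSemidef.mpr hA), h4]

theorem rpow_posSemidef (A : Matrix (Fin d) (Fin d) ℂ) (x : ℝ) : (A ^ x).PosSemidef :=
  nonneg_iff_posSemidef.mp CFC.rpow_nonneg

theorem rpow_conjTranspose (A : Matrix (Fin d) (Fin d) ℂ) (x : ℝ) : (A ^ x)ᴴ = A ^ x :=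
  (rpow_posSemidef A x).isHermitian

theorem rpow_mul_rpow {A : Matrix (Fin d) (Fin d) ℂ} (hA : A.PosSemidef) {x y : ℝ}
    (hx : 0 ≤ x) (hy : 0 ≤ y) : A ^ x * A ^ y = A ^ (x + y) := by
  obtain ⟨U, l, h1, h2, h3, -, h5⟩ := exists_spec_rpow hA
  rw [h5, h5, h5, spec_mul_spec h1]
  congr 1
  ext i
  exact (Real.rpow_add_of_nonneg (h3 i) hx hy).symm

theorem rpow_one' {A : Matrix (Fin d) (Fin d) ℂ} (hA : A.PosSemidef) : A ^ (1 : ℝ) = A :=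
  CFC.rpow_one A (nonneg_iff_posSemidef.mpr hA)

theorem rpow_mul_rpow_eq_self {A : Matrix (Fin d) (Fin d) ℂ} (hA : A.PosSemidef) {x y : ℝ}
    (hx : 0 ≤ x) (hy : 0 ≤ y) (h : x + y = 1) : A ^ x * A ^ y = A := by
  rw [rpow_mul_rpow hA hx hy, h, rpow_one' hA]

theorem rpow_mul_rpow_neg' {A : Matrix (Fin d) (Fin d) ℂ} (hA : A.PosDef) (x : ℝ) :
    A ^ x * A ^ (-x) = 1 :=
  CFC.rpow_mul_rpow_neg x (isStrictlyPositive_iff_posDef.mpr hA)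

theorem smul_rpow {A : Matrix (Fin d) (Fin d) ℂ} (hA : A.PosSemidef) {t : ℝ} (ht : 0 ≤ t)
    (x : ℝ) : ((t : ℂ) • A) ^ x = ((t ^ x : ℝ) : ℂ) • A ^ x := by
  have hs : IsSelfAdjoint A := hA.isHermitian
  have hc : ∀ (c : ℝ) (B : Matrix (Fin d) (Fin d) ℂ), (c : ℂ) • B = c • B :=
    fun c B => by ext i j; simp
  have hp : ((t : ℂ) • A).PosSemidef := hA.smul (by exact_mod_cast ht)
  -- Every function is continuous on a finite spectrum, so negative exponents need no separate
  -- treatment.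
  have hfin : (spectrum ℝ A).Finite := Matrix.finite_real_spectrum
  rw [CFC.rpow_eq_cfc_real (nonneg_iff_posSemidef.mpr hp),
    CFC.rpow_eq_cfc_real (nonneg_iff_posSemidef.mpr hA), hc, hc, ← cfc_const_mul_id t A hs,
    ← cfc_comp' (fun y : ℝ => y ^ x) (fun y : ℝ => t * y) A
      ((hfin.image _).continuousOn _) (hfin.continuousOn _) hs,
    ← cfc_const_mul (t ^ x) (fun y : ℝ => y ^ x) A (hfin.continuousOn _)]
  refine cfc_congr fun y hy => ?_
  exact Real.mul_rpow ht (spectrum_nonneg_of_nonneg (nonneg_iff_posSemidef.mpr hA) hy)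

/-! ### Trace inequalities, Jensen, and positive parts. -/

theorem trace_mul_nonneg {A B : Matrix (Fin d) (Fin d) ℂ} (hA : A.PosSemidef)
    (hB : B.PosSemidef) : 0 ≤ (A * B).trace.re := by
  have h1 : A ^ (1 / 2 : ℝ) * A ^ (1 / 2 : ℝ) = A :=
    rpow_mul_rpow_eq_self hA (by norm_num) (by norm_num) (by norm_num)
  have h2 := (hB.mul_mul_conjTranspose_same (A ^ (1 / 2 : ℝ))).trace_nonneg
  rw [rpow_conjTranspose, trace_mul_comm, ← Matrix.mul_assoc, h1] at h2
  exact (Complex.le_def.mp h2).1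

theorem trace_mul_le_trace_mul {A B C : Matrix (Fin d) (Fin d) ℂ} (hA : A.PosSemidef)
    (h : (C - B).PosSemidef) : (A * B).trace.re ≤ (A * C).trace.re := by
  have := trace_mul_nonneg hA h
  rw [Matrix.mul_sub, trace_sub, Complex.sub_re] at this
  linarith

theorem norm_sq_mul_diag_le (A B : Matrix (Fin d) (Fin d) ℂ) (i : Fin d) :
    ‖(A * B) i i‖ ≤ √((A * Aᴴ) i i).re * √((Bᴴ * B) i i).re := by
  have h1 : ((A * Aᴴ) i i).re = ∑ k, ‖A i k‖ ^ 2 := by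
    simp only [Matrix.mul_apply, conjTranspose_apply, Complex.re_sum]
    refine Finset.sum_congr rfl fun k _ => ?_
    rw [RCLike.star_def, Complex.mul_conj, Complex.ofReal_re, Complex.normSq_eq_norm_sq]
  have h2 : ((Bᴴ * B) i i).re = ∑ k, ‖B k i‖ ^ 2 := by
    simp only [Matrix.mul_apply, conjTranspose_apply, Complex.re_sum]
    refine Finset.sum_congr rfl fun k _ => ?_
    rw [mul_comm, RCLike.star_def, Complex.mul_conj, Complex.ofReal_re, Complex.normSq_eq_norm_sq]
  rw [h1, h2, Matrix.mul_apply]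
  refine (norm_sum_le _ _).trans ?_
  simp only [norm_mul]
  exact Real.sum_mul_le_sqrt_mul_sqrt _ _ _

theorem trace_mul_le_sqrt (A B : Matrix (Fin d) (Fin d) ℂ) :
    (A * B).trace.re ≤ √(A * Aᴴ).trace.re * √(Bᴴ * B).trace.re := by
  have hA : ∀ i, 0 ≤ ((A * Aᴴ) i i).re := fun i =>
    (Complex.le_def.mp ((posSemidef_self_mul_conjTranspose A).diag_nonneg (i := i))).1
  have hB : ∀ i, 0 ≤ ((Bᴴ * B) i i).re := fun i =>
    (Complex.le_def.mp ((posSemidef_conjTranspose_mul_self B).diag_nonneg (i := i))).1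
  simp only [Matrix.trace, diag_apply, Complex.re_sum]
  calc ∑ i, ((A * B) i i).re ≤ ∑ i, √((A * Aᴴ) i i).re * √((Bᴴ * B) i i).re :=
        Finset.sum_le_sum fun i _ => (Complex.re_le_norm _).trans (norm_sq_mul_diag_le A B i)
    _ ≤ √(∑ i, √((A * Aᴴ) i i).re ^ 2) * √(∑ i, √((Bᴴ * B) i i).re ^ 2) :=
        Real.sum_mul_le_sqrt_mul_sqrt _ _ _
    _ = _ := by
        congr 3 <;> ext i
        · exact Real.sq_sqrt (hA i)
        · exact Real.sq_sqrt (hB i)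

/-- Jensen for t ↦ t^r, with weights the squared entries of row i of `Vᴴ * U`. Weights of total mass
at most 1 suffice because the function vanishes at 0; this lets `V` be a compressed unitary `P * W`.
-/
theorem diag_rpow_le {A : Matrix (Fin d) (Fin d) ℂ} (hA : A.PosSemidef)
    (V : Matrix (Fin d) (Fin d) ℂ) (i : Fin d) (hV : ((Vᴴ * V) i i).re ≤ 1) {r : ℝ}
    (hr : 1 ≤ r) : ((Vᴴ * A * V) i i).re ^ r ≤ ((Vᴴ * A ^ r * V) i i).re := by
  obtain ⟨U, l, h1, h2, h3, h4, h5⟩ := exists_spec_rpow hA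
  have key : ∀ m : Fin d → ℝ,
      ((Vᴴ * spec U m * V) i i).re = ∑ j, ‖(Vᴴ * U) i j‖ ^ 2 * m j := by
    intro m
    have e : Vᴴ * spec U m * V = (Vᴴ * U) * diagonal (fun i => (m i : ℂ)) * (Vᴴ * U)ᴴ := by
      simp only [spec, conjTranspose_mul, conjTranspose_conjTranspose, Matrix.mul_assoc]
    rw [e, Matrix.mul_apply, Complex.re_sum]
    refine Finset.sum_congr rfl fun j _ => ?_
    rw [mul_diagonal, conjTranspose_apply, mul_right_comm, RCLike.star_def, Complex.mul_conj,
      ← Complex.ofReal_mul, Complex.ofReal_re, Complex.normSq_eq_norm_sq]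
  have hw : ∑ j, ‖(Vᴴ * U) i j‖ ^ 2 ≤ 1 := by
    have := key (fun _ => 1)
    rw [spec_one h2, Matrix.mul_one] at this
    simp only [mul_one] at this
    rwa [← this]
  rw [h5, key]
  conv_lhs => rw [h4, key]
  set w : Fin d → ℝ := fun j => ‖(Vᴴ * U) i j‖ ^ 2 with hwdef
  have hw0 : ∀ j, 0 ≤ w j := fun j => sq_nonneg _
  have hr0 : (0 : ℝ) < r := by linarith
  have h6 := Real.inner_le_weight_mul_Lp_of_nonneg Finset.univ hr w l hw0 h3
  have h7 : 0 ≤ ∑ j, w j * l j ^ r :=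
    Finset.sum_nonneg fun j _ => mul_nonneg (hw0 j) (Real.rpow_nonneg (h3 j) _)
  have h8 : ∑ j, w j * l j ≤ (∑ j, w j * l j ^ r) ^ r⁻¹ := by
    refine h6.trans ?_
    have : (∑ j, w j) ^ (1 - r⁻¹) ≤ 1 :=
      Real.rpow_le_one (Finset.sum_nonneg fun j _ => hw0 j) hw
        (by rw [sub_nonneg]; exact inv_le_one_of_one_le₀ hr)
    exact mul_le_of_le_one_left (Real.rpow_nonneg h7 _) this
  calc (∑ j, w j * l j) ^ r ≤ ((∑ j, w j * l j ^ r) ^ r⁻¹) ^ r :=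
        Real.rpow_le_rpow (Finset.sum_nonneg fun j _ => mul_nonneg (hw0 j) (h3 j)) h8 hr0.le
    _ = _ := Real.rpow_inv_rpow h7 hr0.ne'

section

open scoped Matrix.Norms.L2Operator

/-- Löwner–Heinz, a C⋆-algebra statement; hence the local L2 operator norm. -/
theorem rpow_le_rpow_of_le {A B : Matrix (Fin d) (Fin d) ℂ} (h : A ≤ B) {s : ℝ} (hs : 0 ≤ s)
    (hs' : s ≤ 1) : (B ^ s - A ^ s).PosSemidef :=
  le_iff.mp (CFC.rpow_le_rpow ⟨hs, hs'⟩ h)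

end

/-- A Jordan decomposition: the positive part `Δ` of `H` and the projection `P` on its support. -/
theorem exists_posPart {H : Matrix (Fin d) (Fin d) ℂ} (hH : H.IsHermitian) :
    ∃ P Δ : Matrix (Fin d) (Fin d) ℂ, P.PosSemidef ∧ (1 - P).PosSemidef ∧ P * P = P ∧
      Δ.PosSemidef ∧ (Δ - H).PosSemidef ∧ P * H = Δ ∧
      schattenOneNorm H = 2 * Δ.trace.re - H.trace.re := by
  obtain ⟨U, l, h1, h2, h3, -⟩ := exists_spec_cfc hH
  refine ⟨spec U (fun i => if 0 < l i then 1 else 0), spec U (fun i => max (l i) 0),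
    ?_, ?_, ?_, ?_, ?_, ?_, ?_⟩
  · exact spec_posSemidef U fun i => by split_ifs <;> norm_num
  · rw [← spec_one h2, spec_sub_spec]
    exact spec_posSemidef U fun i => by split_ifs <;> norm_num
  · rw [spec_mul_spec h1]
    congr 1; ext i; split_ifs <;> norm_num
  · exact spec_posSemidef U fun i => le_max_right _ _
  · rw [h3, spec_sub_spec]
    exact spec_posSemidef U fun i => by simp
  · rw [h3, spec_mul_spec h1]
    congr 1; ext i
    split_ifs with h
    · simp [h.le]
    · simp [not_lt.mp h]
  · have h4 : CFC.sqrt (Hᴴ * H) = spec U (fun i => |l i|) := by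
      refine CFC.sqrt_unique ?_ (nonneg_iff_posSemidef.mpr (spec_posSemidef U fun i => abs_nonneg _))
      rw [hH.eq, h3, spec_mul_spec h1, spec_mul_spec h1]
      simp
    rw [schattenOneNorm, h4, h3, spec_trace h1, spec_trace h1, spec_trace h1, Finset.mul_sum,
      ← Finset.sum_sub_distrib]
    refine Finset.sum_congr rfl fun i _ => ?_
    rcases le_total 0 (l i) with h | h
    · rw [abs_of_nonneg h, max_eq_left h]; ring
    · rw [abs_of_nonpos h, max_eq_right h]; ring

/-- In an eigenbasis u_i of MᴴM, each ⟨u_i, M u_i⟩ is at most ‖M u_i‖, the square root of the i-th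
eigenvalue. -/
theorem trace_re_le_schattenOneNorm (M : Matrix (Fin d) (Fin d) ℂ) :
    M.trace.re ≤ schattenOneNorm M := by
  have hM := posSemidef_conjTranspose_mul_self M
  obtain ⟨U, l, h1, h2, h3, h4, h5⟩ := exists_spec_rpow hM
  rw [schattenOneNorm, CFC.sqrt_eq_rpow, h5, spec_trace h1]
  have e : M.trace = (Uᴴ * (M * U)).trace := by
    rw [trace_mul_comm, Matrix.mul_assoc, h2, Matrix.mul_one]
  rw [e]
  simp only [Matrix.trace, diag_apply, Complex.re_sum]
  refine Finset.sum_le_sum fun i _ => (Complex.re_le_norm _).trans ?_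
  refine (norm_sq_mul_diag_le Uᴴ (M * U) i).trans (le_of_eq ?_)
  have e2 : (M * U)ᴴ * (M * U) = Uᴴ * spec U l * U := by
    rw [← h4, conjTranspose_mul]; simp only [Matrix.mul_assoc]
  rw [e2, spec_diag h1, conjTranspose_conjTranspose, h1]
  simp [Real.sqrt_eq_rpow]

theorem diag_re_nonneg {A : Matrix (Fin d) (Fin d) ℂ} (hA : A.PosSemidef) (i : Fin d) :
    0 ≤ (A i i).re :=
  (Complex.le_def.mp (hA.diag_nonneg (i := i))).1

theorem sum_diag_re (A : Matrix (Fin d) (Fin d) ℂ) : ∑ i, (A i i).re = A.trace.re := by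
  simp [Matrix.trace]

theorem trace_conj {V : Matrix (Fin d) (Fin d) ℂ} (hV : V * Vᴴ = 1)
    (A : Matrix (Fin d) (Fin d) ℂ) : (Vᴴ * A * V).trace = A.trace := by
  rw [trace_mul_comm, ← Matrix.mul_assoc, hV, Matrix.one_mul]

/-! ### Audenaert's inequality and bounds by sandwiched quantities. -/

/-- Audenaert's inequality `tr A - tr (A - B)₊ ≤ tr A^s B^(1-s)`. -/
theorem trace_sub_le_trace_rpow_mul_rpow {A B Δ : Matrix (Fin d) (Fin d) ℂ}
    (hA : A.PosSemidef) (hB : B.PosSemidef) (hΔ : Δ.PosSemidef)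
    (h : (Δ - (A - B)).PosSemidef) {s : ℝ} (hs : 0 ≤ s) (hs' : s ≤ 1) :
    A.trace.re - Δ.trace.re ≤ (A ^ s * B ^ (1 - s)).trace.re := by
  have hC : (B + Δ).PosSemidef := hB.add hΔ
  have hAC : A ≤ B + Δ := by
    rwa [le_iff, show B + Δ - A = Δ - (A - B) by abel]
  have hBC : B ≤ B + Δ := by
    rwa [le_iff, add_sub_cancel_left]
  have hs0 : (0 : ℝ) ≤ 1 - s := by linarith
  -- With C = B + Δ above both A and B: tr A - tr A^s B^(1-s) ≤ tr A^s (C^(1-s) - B^(1-s)) ≤ tr C^s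
  -- (C^(1-s) - B^(1-s)) ≤ tr C - tr B = tr Δ.
  have h1 := trace_mul_le_trace_mul (rpow_posSemidef A s)
    (rpow_le_rpow_of_le hAC hs0 (by linarith))
  have h2 := trace_mul_le_trace_mul (rpow_le_rpow_of_le hBC hs0 (by linarith))
    (rpow_le_rpow_of_le hAC hs hs')
  have h3 := trace_mul_le_trace_mul (rpow_posSemidef B (1 - s))
    (rpow_le_rpow_of_le hBC hs hs')
  rw [rpow_mul_rpow_eq_self hA hs hs0 (by ring)] at h1
  rw [trace_mul_comm, trace_mul_comm (_ - _) ((B + Δ) ^ s), Matrix.mul_sub, Matrix.mul_sub,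
    rpow_mul_rpow_eq_self hC hs hs0 (by ring), trace_sub, trace_sub, Complex.sub_re,
    Complex.sub_re] at h2
  rw [trace_mul_comm, trace_mul_comm _ ((B + Δ) ^ s),
    rpow_mul_rpow_eq_self hB hs hs0 (by ring)] at h3
  rw [trace_add, Complex.add_re] at h2
  linarith

theorem diag_rpow_le_rpow {A : Matrix (Fin d) (Fin d) ℂ} (hA : A.PosSemidef)
    (V : Matrix (Fin d) (Fin d) ℂ) (i : Fin d) (hV : ((Vᴴ * V) i i).re ≤ 1) {θ : ℝ}
    (hθ : 0 < θ) (hθ' : θ ≤ 1) :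
    ((Vᴴ * A ^ θ * V) i i).re ≤ ((Vᴴ * A * V) i i).re ^ θ := by
  have h := diag_rpow_le (rpow_posSemidef A θ) V i hV ((one_le_inv₀ hθ).mpr hθ')
  rw [CFC.rpow_rpow_of_exponent_nonneg A θ θ⁻¹ hθ.le (inv_nonneg.mpr hθ.le)
    (nonneg_iff_posSemidef.mpr hA), mul_inv_cancel₀ hθ.ne', rpow_one' hA] at h
  have h0 := diag_re_nonneg ((rpow_posSemidef A θ).conjTranspose_mul_mul_same V) i
  have := Real.rpow_le_rpow (Real.rpow_nonneg h0 _) h hθ.le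
  rwa [Real.rpow_inv_rpow h0 hθ.ne'] at this

/-- The left side is tr XR with XXᴴ = G. In an eigenbasis of G, Cauchy–Schwarz and Jensen bound the
i-th diagonal term by g_i^(1/2) r_i^(1/2-b), where r is the diagonal of ρ and sums to 1; Hölder
finishes. -/
theorem trace_rpow_mul_rpow_le_sandwiched {ρ σ : Matrix (Fin d) (Fin d) ℂ} (hρ : IsState ρ)
    {b α : ℝ} (hb : 0 < b) (hb' : b < 1 / 2) (hα : α * (1 + 2 * b) = 1) :
    (ρ ^ (1 - b) * σ ^ b).trace.re ≤ ((σ ^ b * ρ * σ ^ b) ^ α).trace.re ^ (1 / 2 + b) := by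
  have hρ0 := hρ.1
  set G := σ ^ b * ρ * σ ^ b with hG
  have hGp : G.PosSemidef := by
    have := hρ0.mul_mul_conjTranspose_same (σ ^ b)
    rwa [rpow_conjTranspose] at this
  obtain ⟨V, g, hV, hV', hg, hGV, hGr⟩ := exists_spec_rpow hGp
  set X := σ ^ b * ρ ^ (1 / 2 : ℝ) with hX
  set R := ρ ^ (1 / 2 - b) with hR
  have hXX : X * Xᴴ = G := by
    rw [hX, conjTranspose_mul, rpow_conjTranspose, rpow_conjTranspose, Matrix.mul_assoc,
      ← Matrix.mul_assoc (ρ ^ (1 / 2 : ℝ)),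
      rpow_mul_rpow_eq_self hρ0 (by norm_num) (by norm_num) (by norm_num), ← Matrix.mul_assoc]
  have hXR : X * R = σ ^ b * ρ ^ (1 - b) := by
    rw [hX, hR, Matrix.mul_assoc, rpow_mul_rpow hρ0 (by norm_num) (by linarith)]
    congr 2; ring
  have hRR : Rᴴ * R = ρ ^ (1 - 2 * b) := by
    rw [hR, rpow_conjTranspose, rpow_mul_rpow hρ0 (by linarith) (by linarith)]
    congr 1; ring
  set r : Fin d → ℝ := fun i => ((Vᴴ * ρ * V) i i).re with hr
  have hr0 : ∀ i, 0 ≤ r i := diag_re_nonneg (hρ0.conjTranspose_mul_mul_same V)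
  have hrsum : ∑ i, r i = 1 := by
    rw [hr, sum_diag_re, trace_conj hV', hρ.2, Complex.one_re]
  have hterm : ∀ i, ((Vᴴ * X * (R * V)) i i).re ≤ g i ^ (1 / 2 : ℝ) * r i ^ (1 / 2 - b) := by
    intro i
    refine (Complex.re_le_norm _).trans ((norm_sq_mul_diag_le _ _ i).trans ?_)
    have e1 : Vᴴ * X * (Vᴴ * X)ᴴ = Vᴴ * spec V g * V := by
      rw [← hGV, ← hXX, conjTranspose_mul, conjTranspose_conjTranspose]
      simp only [Matrix.mul_assoc]
    have e2 : (R * V)ᴴ * (R * V) = Vᴴ * ρ ^ (1 - 2 * b) * V := by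
      rw [← hRR, conjTranspose_mul]
      simp only [Matrix.mul_assoc]
    rw [e1, spec_diag hV, e2, Real.sqrt_eq_rpow, Real.sqrt_eq_rpow]
    simp only [diagonal_apply_eq, Complex.ofReal_re]
    refine mul_le_mul_of_nonneg_left ?_ (Real.rpow_nonneg (hg i) _)
    have h1 := diag_rpow_le_rpow hρ0 V i (by rw [hV]; simp) (θ := 1 - 2 * b)
      (by linarith) (by linarith)
    have h2 := Real.rpow_le_rpow (diag_re_nonneg
      ((rpow_posSemidef ρ (1 - 2 * b)).conjTranspose_mul_mul_same V) i) h1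
      (show (0 : ℝ) ≤ 1 / 2 by norm_num)
    rw [← Real.rpow_mul (hr0 i)] at h2
    rwa [show (1 - 2 * b) * (1 / 2) = 1 / 2 - b by ring] at h2
  have hp : (1 / (1 / 2 + b) : ℝ).HolderConjugate (1 / (1 / 2 - b)) := by
    rw [Real.holderConjugate_iff]
    refine ⟨?_, ?_⟩
    · rw [lt_div_iff₀ (by linarith)]; linarith
    · simp only [one_div, inv_inv]; ring
  calc (ρ ^ (1 - b) * σ ^ b).trace.re = ∑ i, ((Vᴴ * X * (R * V)) i i).re := by
        rw [sum_diag_re, trace_mul_comm, ← hXR, ← trace_conj hV' (X * R)]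
        simp only [Matrix.mul_assoc]
    _ ≤ ∑ i, g i ^ (1 / 2 : ℝ) * r i ^ (1 / 2 - b) := Finset.sum_le_sum fun i _ => hterm i
    _ ≤ (∑ i, (g i ^ (1 / 2 : ℝ)) ^ (1 / (1 / 2 + b))) ^ (1 / (1 / (1 / 2 + b))) *
        (∑ i, (r i ^ (1 / 2 - b)) ^ (1 / (1 / 2 - b))) ^ (1 / (1 / (1 / 2 - b))) :=
        Real.inner_le_Lp_mul_Lq_of_nonneg _ hp (fun i _ => Real.rpow_nonneg (hg i) _)
          (fun i _ => Real.rpow_nonneg (hr0 i) _)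
    _ = _ := by
        have e1 : ∀ i, (r i ^ (1 / 2 - b)) ^ (1 / (1 / 2 - b)) = r i := fun i => by
          rw [one_div (1 / 2 - b), Real.rpow_rpow_inv (hr0 i) (by linarith)]
        have e2 : ∀ i, (g i ^ (1 / 2 : ℝ)) ^ (1 / (1 / 2 + b)) = g i ^ α := fun i => by
          rw [← Real.rpow_mul (hg i)]
          congr 1
          rw [eq_div_of_mul_eq (by linarith) hα]
          field_simp
        simp only [e1, e2, hrsum, Real.one_rpow, mul_one, one_div_one_div]
        rw [hGr, spec_trace hV]

theorem trace_mul_pow_comm (A B : Matrix (Fin d) (Fin d) ℂ) {k : ℕ} (hk : k ≠ 0) :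
    ((A * B) ^ k).trace = ((B * A) ^ k).trace := by
  obtain ⟨m, rfl⟩ := Nat.exists_eq_succ_of_ne_zero hk
  have h : ∀ m : ℕ, (A * B) ^ m * A = A * (B * A) ^ m := by
    intro m
    induction m with
    | zero => simp
    | succ m ih => rw [pow_succ', Matrix.mul_assoc, ih, pow_succ']; simp only [Matrix.mul_assoc]
  rw [Nat.succ_eq_add_one, pow_succ, ← Matrix.mul_assoc, h, Matrix.mul_assoc, trace_mul_comm,
    Matrix.mul_assoc, ← pow_succ]

/-- `tr (P A^(1/k) P)^k ≤ tr P A` for a projection `P`. -/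
theorem trace_compress_pow_le {A P : Matrix (Fin d) (Fin d) ℂ} (hA : A.PosSemidef)
    (hP : P.PosSemidef) (hP1 : (1 - P).PosSemidef) (hPP : P * P = P) {k : ℕ} (hk : k ≠ 0) :
    ((P * A ^ ((1 : ℝ) / k) * P) ^ k).trace.re ≤ (P * A).trace.re := by
  have hPh : Pᴴ = P := hP.isHermitian
  have hk0 : (0 : ℝ) < 1 / k := by positivity
  have hY : (P * A ^ ((1 : ℝ) / k) * P).PosSemidef := by
    have := (rpow_posSemidef A ((1 : ℝ) / k)).mul_mul_conjTranspose_same P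
    rwa [hPh] at this
  obtain ⟨W, y, hW, hW', hy, hYW, -⟩ := exists_spec_rpow hY
  have hle : ∀ i, (((P * W)ᴴ * (P * W)) i i).re ≤ 1 := by
    intro i
    have h1 := diag_re_nonneg (hP1.conjTranspose_mul_mul_same W) i
    have e : (P * W)ᴴ * (P * W) = Wᴴ * P * W := by
      rw [conjTranspose_mul, hPh, Matrix.mul_assoc, ← Matrix.mul_assoc P, hPP, ← Matrix.mul_assoc]
    rw [Matrix.mul_sub, Matrix.sub_mul, Matrix.mul_one, hW, Matrix.sub_apply, one_apply_eq,
      Complex.sub_re, Complex.one_re] at h1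
    rw [e]; linarith
  have hyi : ∀ i, y i = (((P * W)ᴴ * A ^ ((1 : ℝ) / k) * (P * W)) i i).re := by
    intro i
    have e : (P * W)ᴴ * A ^ ((1 : ℝ) / k) * (P * W) = Wᴴ * spec W y * W := by
      rw [← hYW, conjTranspose_mul, hPh]; simp only [Matrix.mul_assoc]
    rw [e, spec_diag hW]; simp
  have hpow : ∀ i, y i ^ k ≤ (((P * W)ᴴ * A * (P * W)) i i).re := by
    intro i
    have h := diag_rpow_le (rpow_posSemidef A ((1 : ℝ) / k)) (P * W) i (hle i)
      (r := k) (by exact_mod_cast Nat.one_le_iff_ne_zero.mpr hk)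
    rw [← hyi, Real.rpow_natCast, CFC.rpow_rpow_of_exponent_nonneg A _ _ hk0.le (by positivity)
      (nonneg_iff_posSemidef.mpr hA), one_div_mul_cancel (by positivity), rpow_one' hA] at h
    exact h
  rw [hYW, spec_pow hW hW', spec_trace hW]
  refine (Finset.sum_le_sum fun i _ => hpow i).trans (le_of_eq ?_)
  have e : (P * W)ᴴ * A * (P * W) = Wᴴ * (P * A * P) * W := by
    rw [conjTranspose_mul, hPh]; simp only [Matrix.mul_assoc]
  rw [sum_diag_re, e, trace_conj hW', trace_mul_comm, ← Matrix.mul_assoc, hPP]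

/-- Data processing of the sandwiched divergence of order `k / (k - 1)` under a projective
two-outcome measurement. -/
theorem trace_proj_mul_le_sandwiched {ρ σ P : Matrix (Fin d) (Fin d) ℂ} (hρ : ρ.PosSemidef)
    (hσ : σ.PosDef) (hP : P.PosSemidef) (hP1 : (1 - P).PosSemidef) (hPP : P * P = P) {k : ℕ}
    (hk : 2 ≤ k) {α : ℝ} (hα : α * (1 - 1 / k) = 1) :
    (P * ρ).trace.re ≤
      ((σ ^ (-(1 / (2 * k)) : ℝ) * ρ * σ ^ (-(1 / (2 * k)) : ℝ)) ^ α).trace.re ^ (1 - 1 / k : ℝ) *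
        (P * σ).trace.re ^ (1 / k : ℝ) := by
  have hk0 : k ≠ 0 := by omega
  have hk2 : (2 : ℝ) ≤ k := by exact_mod_cast hk
  have hPh : Pᴴ = P := hP.isHermitian
  set S := σ ^ (1 / (2 * k) : ℝ) with hS
  set T := σ ^ (-(1 / (2 * k)) : ℝ) with hT
  set G := T * ρ * T with hG
  have hSS : S * S = σ ^ ((1 : ℝ) / k) := by
    rw [hS, rpow_mul_rpow hσ.posSemidef (by positivity) (by positivity)]
    congr 1; field_simp; ring
  have hSh : Sᴴ = S := rpow_conjTranspose _ _
  have hST : S * T = 1 := rpow_mul_rpow_neg' hσ _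
  have hTS : T * S = 1 := mul_eq_one_comm.mp hST
  have hGp : G.PosSemidef := by
    have := hρ.mul_mul_conjTranspose_same T
    rwa [hT, rpow_conjTranspose] at this
  have hSGS : S * G * S = ρ := by
    have : S * G * S = (S * T) * ρ * (T * S) := by rw [hG]; simp only [Matrix.mul_assoc]
    rw [this, hST, hTS, Matrix.one_mul, Matrix.mul_one]
  -- tr Pρ = tr GZ, and Hölder in an eigenbasis of G separates the two factors.
  set Z := S * P * S with hZ
  have hZp : Z.PosSemidef := by
    have := hP.mul_mul_conjTranspose_same S
    rwa [hSh] at this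
  obtain ⟨V, g, hV, hV', hg, hGV, hGr⟩ := exists_spec_rpow hGp
  set z : Fin d → ℝ := fun i => ((Vᴴ * Z * V) i i).re with hz
  have hz0 : ∀ i, 0 ≤ z i := diag_re_nonneg (hZp.conjTranspose_mul_mul_same V)
  have hzk : ∀ i, z i ^ (k : ℝ) ≤ ((Vᴴ * Z ^ k * V) i i).re := by
    intro i
    have h := diag_rpow_le hZp V i (by rw [hV]; simp) (r := k) (by linarith)
    rwa [CFC.rpow_natCast Z k (nonneg_iff_posSemidef.mpr hZp)] at h
  -- Since Z = (SP)(PS), cyclicity turns tr Z^k into tr (P σ^(1/k) P)^k. An integer k makes this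
  -- purely algebraic.
  have hsum : ∑ i, z i ^ (k : ℝ) ≤ (P * σ).trace.re := by
    refine (Finset.sum_le_sum fun i _ => hzk i).trans ?_
    rw [sum_diag_re, trace_conj hV']
    have e1 : Z = (S * P) * (P * S) := by
      rw [hZ, Matrix.mul_assoc, Matrix.mul_assoc, ← Matrix.mul_assoc P P, hPP]
    have e2 : (P * S) * (S * P) = P * σ ^ ((1 : ℝ) / k) * P := by
      rw [← hSS]; simp only [Matrix.mul_assoc]
    rw [e1, trace_mul_pow_comm _ _ hk0, e2]
    exact trace_compress_pow_le hσ.posSemidef hP hP1 hPP hk0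
  have hα' : α = (1 - 1 / k : ℝ)⁻¹ := by
    refine eq_inv_of_mul_eq_one_left hα
  have hk1 : (1 : ℝ) / k ≤ 1 / 2 := by
    apply one_div_le_one_div_of_le <;> linarith
  have hp : α.HolderConjugate (k : ℝ) := by
    rw [Real.holderConjugate_iff]
    refine ⟨?_, ?_⟩
    · have : (0 : ℝ) < 1 / k := by positivity
      rw [hα', one_lt_inv₀] <;> linarith
    · rw [hα', inv_inv, one_div]; ring
  calc (P * ρ).trace.re = ∑ i, g i * z i := by
        rw [← hSGS]
        have e : (P * (S * G * S)).trace = (Vᴴ * (G * Z) * V).trace := by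
          rw [trace_conj hV', trace_mul_comm, hZ]
          have : S * G * S * P = S * (G * (S * P)) := by simp only [Matrix.mul_assoc]
          rw [this, trace_mul_comm]
          simp only [Matrix.mul_assoc]
        have e2 : Vᴴ * (G * Z) * V = diagonal (fun i => (g i : ℂ)) * (Vᴴ * Z * V) := by
          rw [← spec_diag hV, ← hGV]
          have : Vᴴ * G * V * (Vᴴ * Z * V) = Vᴴ * (G * (V * Vᴴ) * Z) * V := by
            simp only [Matrix.mul_assoc]
          rw [this, hV', Matrix.mul_one]
        rw [e, e2, ← sum_diag_re]
        refine Finset.sum_congr rfl fun i _ => ?_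
        rw [diagonal_mul, Complex.re_ofReal_mul]
    _ ≤ (∑ i, g i ^ α) ^ (1 / α) * (∑ i, z i ^ (k : ℝ)) ^ (1 / (k : ℝ)) :=
        Real.inner_le_Lp_mul_Lq_of_nonneg _ hp (fun i _ => hg i) (fun i _ => hz0 i)
    _ ≤ _ := by
        rw [hGr, spec_trace hV]
        have e : 1 / α = 1 - 1 / (k : ℝ) := by rw [hα', one_div, inv_inv]
        rw [e]
        refine mul_le_mul_of_nonneg_left ?_
          (Real.rpow_nonneg (Finset.sum_nonneg fun i _ => Real.rpow_nonneg (hg i) _) _)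
        exact Real.rpow_le_rpow (Finset.sum_nonneg fun i _ => Real.rpow_nonneg (hz0 i) _) hsum
          (by positivity)

/-! ### The test on the first pair and the smoothing of the second. -/

theorem trace_mul_eq_ofReal {A B : Matrix (Fin d) (Fin d) ℂ} (hA : A.IsHermitian)
    (hB : B.IsHermitian) : (A * B).trace = (((A * B).trace.re : ℝ) : ℂ) := by
  have h : star (A * B).trace = (A * B).trace := by
    rw [← trace_conjTranspose, conjTranspose_mul, hA.eq, hB.eq, trace_mul_comm]
  exact (Complex.conj_eq_iff_re.mp h).symm

theorem trace_eq_ofReal {A : Matrix (Fin d) (Fin d) ℂ} (hA : A.IsHermitian) :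
    A.trace = ((A.trace.re : ℝ) : ℂ) := by
  have := trace_mul_eq_ofReal hA isHermitian_one
  rwa [Matrix.mul_one] at this

theorem ofReal_smul_posSemidef {A : Matrix (Fin d) (Fin d) ℂ} (hA : A.PosSemidef) {c : ℝ}
    (hc : 0 ≤ c) : ((c : ℂ) • A).PosSemidef :=
  hA.smul (by exact_mod_cast hc)

theorem trace_mul_le_trace {A E : Matrix (Fin d) (Fin d) ℂ} (hA : A.PosSemidef)
    (hE : (1 - E).PosSemidef) : (E * A).trace.re ≤ A.trace.re := by
  have := trace_mul_le_trace_mul hA hE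
  rwa [Matrix.mul_one, trace_mul_comm] at this

theorem ofReal_smul_trace_mul (c : ℝ) (A B : Matrix (Fin d) (Fin d) ℂ) :
    (A * ((c : ℂ) • B)).trace.re = c * (A * B).trace.re := by
  rw [Matrix.mul_smul, trace_smul, smul_eq_mul, Complex.re_ofReal_mul]

/-- A test with error trade-off controlled by the sandwiched divergence of order `α < 1`. -/
theorem exists_test {ρ σ : Matrix (Fin d) (Fin d) ℂ} (hρ : IsState ρ) (hσ : σ.PosSemidef)
    {b α t : ℝ} (hb : 0 < b) (hb' : b < 1 / 2) (hα : α * (1 + 2 * b) = 1) (ht : 0 ≤ t) :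
    ∃ E : Matrix (Fin d) (Fin d) ℂ, E.PosSemidef ∧ (1 - E).PosSemidef ∧
      ((1 - E) * ρ).trace.re + t * (E * σ).trace.re ≤
        t ^ b * ((σ ^ b * ρ * σ ^ b) ^ α).trace.re ^ (1 / 2 + b) := by
  have htσ := ofReal_smul_posSemidef hσ ht
  obtain ⟨P, Δ, hP, hP1, -, hΔ, hΔH, hPH, -⟩ :=
    exists_posPart (hρ.1.isHermitian.sub htσ.isHermitian)
  refine ⟨P, hP, hP1, ?_⟩
  have h1 := trace_sub_le_trace_rpow_mul_rpow hρ.1 htσ hΔ hΔH (s := 1 - b)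
    (by linarith) (by linarith)
  rw [sub_sub_cancel, smul_rpow hσ ht, ofReal_smul_trace_mul] at h1
  have h2 : Δ.trace.re = (P * ρ).trace.re - t * (P * σ).trace.re := by
    rw [← hPH, Matrix.mul_sub, trace_sub, Complex.sub_re, ofReal_smul_trace_mul]
  have h3 : ((1 - P) * ρ).trace.re = ρ.trace.re - (P * ρ).trace.re := by
    rw [Matrix.sub_mul, Matrix.one_mul, trace_sub, Complex.sub_re]
  have h4 := mul_le_mul_of_nonneg_left (trace_rpow_mul_rpow_le_sandwiched hρ hb hb' hα (σ := σ))
    (Real.rpow_nonneg ht b)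
  linarith

/-- MMᴴ - NNᴴ = (M - N)Mᴴ + N(M - N)ᴴ, and Cauchy–Schwarz bounds each term by √η. Closeness of
square-root factors thus passes to the states. -/
theorem trace_mul_sub_mul_conjTranspose_le {M N P : Matrix (Fin d) (Fin d) ℂ} {η : ℝ}
    (hM : (M * Mᴴ).trace.re ≤ 1) (hN : (N * Nᴴ).trace.re ≤ 1)
    (hMN : ((M - N)ᴴ * (M - N)).trace.re ≤ η) (hP : P.PosSemidef) (hP1 : (1 - P).PosSemidef)
    (hPP : P * P = P) : (P * (M * Mᴴ - N * Nᴴ)).trace.re ≤ 2 * √η := by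
  have hPh : Pᴴ = P := hP.isHermitian
  have key : ∀ X : Matrix (Fin d) (Fin d) ℂ, (X * Xᴴ).trace.re ≤ 1 →
      (Xᴴ * P * (M - N)).trace.re ≤ √η := by
    intro X hX
    refine (trace_mul_le_sqrt _ _).trans ?_
    have e : (Xᴴ * P * (Xᴴ * P)ᴴ).trace = (P * (X * Xᴴ)).trace := by
      rw [conjTranspose_mul, conjTranspose_conjTranspose, hPh, Matrix.mul_assoc,
        ← Matrix.mul_assoc P, hPP, trace_mul_comm, Matrix.mul_assoc]
    rw [e]
    have h1 : √(P * (X * Xᴴ)).trace.re ≤ 1 := by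
      rw [Real.sqrt_le_one]
      exact (trace_mul_le_trace (posSemidef_self_mul_conjTranspose X) hP1).trans hX
    calc _ ≤ 1 * √η := mul_le_mul h1 (Real.sqrt_le_sqrt hMN) (Real.sqrt_nonneg _) zero_le_one
      _ = √η := one_mul _
  have e1 : (P * (M * Mᴴ - N * Nᴴ)).trace =
      (Mᴴ * P * (M - N)).trace + star (Nᴴ * P * (M - N)).trace := by
    have a1 : (Mᴴ * P * (M - N)).trace = (P * ((M - N) * Mᴴ)).trace := by
      rw [Matrix.mul_assoc, trace_mul_comm, Matrix.mul_assoc]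
    have a2 : star (Nᴴ * P * (M - N)).trace = (P * (N * (M - N)ᴴ)).trace := by
      rw [← trace_conjTranspose, conjTranspose_mul, conjTranspose_mul,
        conjTranspose_conjTranspose, hPh, trace_mul_comm, Matrix.mul_assoc]
    rw [a1, a2, ← trace_add, ← Matrix.mul_add, conjTranspose_sub]
    congr 2
    noncomm_ring
  rw [e1, Complex.add_re]
  have h2 : (star (Nᴴ * P * (M - N)).trace).re = (Nᴴ * P * (M - N)).trace.re := by simp
  rw [h2]
  linarith [key M hM, key N hN]

/-- Smoothing: a state close to `ρ` and dominated by `(c + 1) σ`, where the error is the trace of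
the positive part of `ρ - c σ`. -/
theorem exists_smoothing {ρ σ Δ : Matrix (Fin d) (Fin d) ℂ} (hρ : IsState ρ) (hσ : IsState σ)
    (hσ' : σ.PosDef) {c : ℝ} (hc : 0 < c) (hΔ : Δ.PosSemidef)
    (hΔH : (Δ - (ρ - (c : ℂ) • σ)).PosSemidef) :
    ∃ ω : Matrix (Fin d) (Fin d) ℂ, IsState ω ∧ (((c + 1 : ℝ) : ℂ) • σ - ω).PosSemidef ∧
      ∀ P : Matrix (Fin d) (Fin d) ℂ, P.PosSemidef → (1 - P).PosSemidef → P * P = P →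
        (P * (ω - ρ)).trace.re ≤ 4 * √(2 * Δ.trace.re) := by
  set Λ := (c : ℂ) • σ with hΛdef
  have hΛ : Λ.PosDef := hσ'.smul (by exact_mod_cast hc)
  set C := Λ + Δ with hCdef
  have hC : C.PosDef := hΛ.add_posSemidef hΔ
  have hCρ : (C - ρ).PosSemidef := by
    rwa [show C - ρ = Δ - (ρ - Λ) by rw [hCdef]; abel]
  set S := C ^ (1 / 2 : ℝ) with hS
  set T := C ^ (-(1 / 2) : ℝ) with hT
  set L := Λ ^ (1 / 2 : ℝ) with hL
  have hST : S * T = 1 := rpow_mul_rpow_neg' hC _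
  have hTS : T * S = 1 := mul_eq_one_comm.mp hST
  have hSS : S * S = C :=
    rpow_mul_rpow_eq_self hC.posSemidef (by norm_num) (by norm_num) (by norm_num)
  have hLL : L * L = Λ :=
    rpow_mul_rpow_eq_self hΛ.posSemidef (by norm_num) (by norm_num) (by norm_num)
  have hLh : Lᴴ = L := rpow_conjTranspose _ _
  have hTh : Tᴴ = T := rpow_conjTranspose _ _
  have hTCT : T * C * T = 1 := by
    rw [← hSS, ← Matrix.mul_assoc, hTS, Matrix.one_mul, hST]
  -- G = Λ^(1/2) C^(-1/2) is a contraction with GCGᴴ = Λ. As ρ ≤ C, this forces GρGᴴ ≤ Λ.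
  set G := L * T with hG
  have hGh : Gᴴ = T * L := by rw [hG, conjTranspose_mul, hLh, hTh]
  have hGC : G * C = L * S := by
    rw [hG, ← hSS, Matrix.mul_assoc, ← Matrix.mul_assoc T, hTS, Matrix.one_mul]
  have hGCG : G * C * Gᴴ = Λ := by
    rw [hGC, hGh, Matrix.mul_assoc, ← Matrix.mul_assoc S, hST, Matrix.one_mul, hLL]
  have hGG : (1 - Gᴴ * G).PosSemidef := by
    have h := hΔ.mul_mul_conjTranspose_same T
    have e : T * Δ * Tᴴ = 1 - Gᴴ * G := by
      have e1 : Gᴴ * G = T * Λ * T := by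
        rw [hGh, hG, ← hLL]; simp only [Matrix.mul_assoc]
      rw [e1, hTh, ← hTCT, hCdef]; noncomm_ring
    rwa [e] at h
  set R := ρ ^ (1 / 2 : ℝ) with hR
  have hRh : Rᴴ = R := rpow_conjTranspose _ _
  have hRR : R * R = ρ :=
    rpow_mul_rpow_eq_self hρ.1 (by norm_num) (by norm_num) (by norm_num)
  have hρ1 : ρ.trace.re = 1 := by rw [hρ.2, Complex.one_re]
  have hσ1 : σ.trace.re = 1 := by rw [hσ.2, Complex.one_re]
  set τ := G * ρ * Gᴴ with hτ
  have hτp : τ.PosSemidef := hρ.1.mul_mul_conjTranspose_same G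
  have hMM : (G * R) * (G * R)ᴴ = τ := by
    rw [conjTranspose_mul, hRh, hτ, ← hRR]; simp only [Matrix.mul_assoc]
  have hNN : R * Rᴴ = ρ := by rw [hRh, hRR]
  have hτ1 : τ.trace.re ≤ 1 := by
    rw [hτ, trace_mul_comm, ← Matrix.mul_assoc, ← hρ1]
    exact trace_mul_le_trace hρ.1 hGG
  -- Contractivity gives (1 - G)ᴴ(1 - G) ≤ K, the Hermitian matrix 2 - G - Gᴴ. Then tr ρK ≤ tr CK =
  -- 2(tr C - Re tr GC), and tr GC = tr Λ^(1/2) C^(1/2) has real part at least tr Λ by operator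
  -- monotonicity of the square root.
  have hη : ((G * R - R)ᴴ * (G * R - R)).trace.re ≤ 2 * Δ.trace.re := by
    set K : Matrix (Fin d) (Fin d) ℂ := 1 - G + (1 - Gᴴ) with hK
    have hKe : K - (1 - G)ᴴ * (1 - G) = 1 - Gᴴ * G := by
      rw [hK, conjTranspose_sub, conjTranspose_one]; noncomm_ring
    have hKp : K.PosSemidef := by
      have := (posSemidef_conjTranspose_mul_self (1 - G)).add hGG
      rwa [← hKe, add_sub_cancel] at this
    have h1 : ((G * R - R)ᴴ * (G * R - R)).trace.re ≤ (ρ * K).trace.re := by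
      have e : ((G * R - R)ᴴ * (G * R - R)).trace = (ρ * ((1 - G)ᴴ * (1 - G))).trace := by
        have e1 : G * R - R = -((1 - G) * R) := by noncomm_ring
        rw [e1, conjTranspose_neg, neg_mul_neg, conjTranspose_mul, hRh, ← hRR,
          Matrix.mul_assoc R R, trace_mul_comm R (R * _), Matrix.mul_assoc]
        simp only [Matrix.mul_assoc]
      rw [e]
      refine trace_mul_le_trace_mul hρ.1 ?_
      rwa [hKe]
    have h2 := trace_mul_le_trace_mul hKp hCρ
    have h3 : (K * C).trace.re = 2 * (C.trace.re - (G * C).trace.re) := by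
      have e : (Gᴴ * C).trace.re = (G * C).trace.re := by
        have : (Gᴴ * C).trace = star (G * C).trace := by
          rw [← trace_conjTranspose, conjTranspose_mul G C, hC.isHermitian.eq, trace_mul_comm]
        rw [this]; simp
      rw [hK, Matrix.add_mul, Matrix.sub_mul, Matrix.sub_mul, Matrix.one_mul]
      simp only [trace_add, trace_sub, Complex.add_re, Complex.sub_re, e]
      ring
    have hΛC : Λ ≤ C := by rwa [le_iff, hCdef, add_sub_cancel_left]
    have h4 := trace_mul_le_trace_mul (rpow_posSemidef Λ (1 / 2))
      (rpow_le_rpow_of_le hΛC (s := 1 / 2) (by norm_num) (by norm_num))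
    rw [hLL, ← hGC] at h4
    have h5 : C.trace.re = Λ.trace.re + Δ.trace.re := by rw [hCdef, trace_add, Complex.add_re]
    rw [trace_mul_comm ρ K] at h1
    linarith
  have hη' : ((R - G * R)ᴴ * (R - G * R)).trace.re ≤ 2 * Δ.trace.re := by
    rwa [← neg_sub, conjTranspose_neg, neg_mul_neg]
  have hMM1 : ((G * R) * (G * R)ᴴ).trace.re ≤ 1 := by rwa [hMM]
  have hNN1 : (R * Rᴴ).trace.re ≤ 1 := by rw [hNN, hρ1]
  have hdef : 1 - τ.trace.re ≤ 2 * √(2 * Δ.trace.re) := by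
    have := trace_mul_sub_mul_conjTranspose_le hNN1 hMM1 hη' PosSemidef.one
      (by simpa using PosSemidef.zero) (Matrix.one_mul 1)
    rwa [hMM, hNN, Matrix.one_mul, trace_sub, Complex.sub_re, hρ1] at this
  -- The missing trace is refilled with σ; it is at most 1, which accounts for c + 1.
  refine ⟨τ + ((1 - τ.trace.re : ℝ) : ℂ) • σ, ⟨?_, ?_⟩, ?_, ?_⟩
  · exact hτp.add (ofReal_smul_posSemidef hσ.1 (by linarith))
  · rw [trace_add, trace_smul, hσ.2, smul_eq_mul, mul_one, Complex.ofReal_sub,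
      ← trace_eq_ofReal hτp.isHermitian]
    simp
  · have e : ((c + 1 : ℝ) : ℂ) • σ - (τ + ((1 - τ.trace.re : ℝ) : ℂ) • σ) =
        G * (C - ρ) * Gᴴ + ((τ.trace.re : ℝ) : ℂ) • σ := by
      rw [Matrix.mul_sub, Matrix.sub_mul, hGCG, ← hτ, hΛdef]
      push_cast
      module
    rw [e]
    refine (hCρ.mul_mul_conjTranspose_same G).add (ofReal_smul_posSemidef hσ.1 ?_)
    exact (Complex.le_def.mp hτp.trace_nonneg).1
  · intro P hP hP1 hPP
    have h1 := trace_mul_sub_mul_conjTranspose_le hMM1 hNN1 hη hP hP1 hPP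
    rw [hMM, hNN] at h1
    have e : P * (τ + ((1 - τ.trace.re : ℝ) : ℂ) • σ - ρ) =
        P * (τ - ρ) + P * (((1 - τ.trace.re : ℝ) : ℂ) • σ) := by
      rw [← Matrix.mul_add]; congr 1; abel
    rw [e, trace_add, Complex.add_re, ofReal_smul_trace_mul]
    have h2 : (1 - τ.trace.re) * (P * σ).trace.re ≤ (1 - τ.trace.re) * 1 :=
      mul_le_mul_of_nonneg_left ((trace_mul_le_trace hσ.1 hP1).trans hσ1.le) (by linarith)
    linarith

/-- Data processing for the trivial projection. It makes the upper rate u nonnegative, hence the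
threshold at least 1. -/
theorem one_le_sandwiched {ρ σ : Matrix (Fin d) (Fin d) ℂ} (hρ : IsState ρ) (hσ : IsState σ)
    (hσ' : σ.PosDef) {k : ℕ} (hk : 2 ≤ k) {α : ℝ} (hα : α * (1 - 1 / k) = 1) :
    1 ≤ ((σ ^ (-(1 / (2 * k)) : ℝ) * ρ * σ ^ (-(1 / (2 * k)) : ℝ)) ^ α).trace.re := by
  have hk2 : (2 : ℝ) ≤ k := by exact_mod_cast hk
  have hk1 : (1 : ℝ) / k ≤ 1 / 2 := by
    apply one_div_le_one_div_of_le <;> linarith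
  have h := trace_proj_mul_le_sandwiched hρ.1 hσ' PosSemidef.one
    (by simpa using PosSemidef.zero) (Matrix.one_mul 1) hk hα
  rw [Matrix.one_mul, Matrix.one_mul, hρ.2, hσ.2, Complex.one_re, Real.one_rpow, mul_one] at h
  have h0 := (Complex.le_def.mp (rpow_posSemidef
    (σ ^ (-(1 / (2 * k)) : ℝ) * ρ * σ ^ (-(1 / (2 * k)) : ℝ)) α).trace_nonneg).1
  by_contra hlt
  exact absurd h (not_le.mpr (Real.rpow_lt_one h0 (not_le.mp hlt) (by linarith)))

/-- The trace of the positive part of `ρ - c σ` is controlled by the sandwiched divergence of order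
`k / (k - 1)`. -/
theorem exists_posPart_trace_le {ρ σ : Matrix (Fin d) (Fin d) ℂ} (hρ : IsState ρ)
    (hσ' : σ.PosDef) {k : ℕ} (hk : 2 ≤ k) {α : ℝ} (hα : α * (1 - 1 / k) = 1) {c : ℝ}
    (hc : 0 < c) :
    ∃ Δ : Matrix (Fin d) (Fin d) ℂ, Δ.PosSemidef ∧ (Δ - (ρ - (c : ℂ) • σ)).PosSemidef ∧
      Δ.trace.re ≤ c ^ (1 - α) *
        ((σ ^ (-(1 / (2 * k)) : ℝ) * ρ * σ ^ (-(1 / (2 * k)) : ℝ)) ^ α).trace.re := by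
  have hk2 : (2 : ℝ) ≤ k := by exact_mod_cast hk
  have hk1 : (1 : ℝ) / k ≤ 1 / 2 := by
    apply one_div_le_one_div_of_le <;> linarith
  have hcσ := ofReal_smul_posSemidef hσ'.posSemidef hc.le
  obtain ⟨P, Δ, hP, hP1, hPP, hΔ, hΔH, hPH, -⟩ :=
    exists_posPart (hρ.1.isHermitian.sub hcσ.isHermitian)
  refine ⟨Δ, hΔ, hΔH, ?_⟩
  have h := trace_proj_mul_le_sandwiched hρ.1 hσ' hP hP1 hPP hk hα
  set Q := ((σ ^ (-(1 / (2 * k)) : ℝ) * ρ * σ ^ (-(1 / (2 * k)) : ℝ)) ^ α).trace.re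
  have hQ : 0 ≤ Q := (Complex.le_def.mp (rpow_posSemidef _ α).trace_nonneg).1
  have hΔ0 : 0 ≤ Δ.trace.re := (Complex.le_def.mp hΔ.trace_nonneg).1
  have h2 : Δ.trace.re = (P * ρ).trace.re - c * (P * σ).trace.re := by
    rw [← hPH, Matrix.mul_sub, trace_sub, Complex.sub_re, ofReal_smul_trace_mul]
  have hPσ := trace_mul_nonneg hP hσ'.posSemidef
  set x := (P * ρ).trace.re
  set y := (P * σ).trace.re
  have hx : Δ.trace.re ≤ x := by nlinarith
  refine hx.trans ?_
  have hα0 : 0 < α := by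
    by_contra hneg
    nlinarith
  rcases (hΔ0.trans hx).eq_or_lt with h0 | hx0
  · rw [← h0]; positivity
  have hy : y ≤ x / c := by rw [le_div_iff₀ hc]; linarith
  -- Positivity of Δ gives cy ≤ x, so data processing bounds x by Q^(1-1/k) (x/c)^(1/k); this is now
  -- solved for x.
  have h3 : x ^ (1 - 1 / k : ℝ) ≤ Q ^ (1 - 1 / k : ℝ) * c ^ (-(1 / k) : ℝ) := by
    have hxk : 0 < x ^ (1 / k : ℝ) := Real.rpow_pos_of_pos hx0 _
    have h4 : y ^ (1 / k : ℝ) ≤ c ^ (-(1 / k) : ℝ) * x ^ (1 / k : ℝ) := by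
      refine (Real.rpow_le_rpow hPσ hy (by positivity)).trans (le_of_eq ?_)
      rw [Real.div_rpow hx0.le hc.le, Real.rpow_neg hc.le]
      field_simp
    refine le_of_mul_le_mul_right ?_ hxk
    rw [← Real.rpow_add hx0, sub_add_cancel, Real.rpow_one, mul_assoc]
    exact h.trans (mul_le_mul_of_nonneg_left h4 (Real.rpow_nonneg hQ _))
  have h5 := Real.rpow_le_rpow (Real.rpow_nonneg hx0.le _) h3 hα0.le
  rw [Real.mul_rpow (Real.rpow_nonneg hQ _) (Real.rpow_nonneg hc.le _), ← Real.rpow_mul hx0.le,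
    ← Real.rpow_mul hQ, ← Real.rpow_mul hc.le, mul_comm _ α, hα, Real.rpow_one,
    Real.rpow_one, mul_comm Q] at h5
  rwa [show (-(1 / k) * α : ℝ) = 1 - α by linear_combination hα] at h5

/-! ### Test-and-prepare channels and their error. -/

/-- The test-and-prepare map `X ↦ tr(E X) γ₁ + tr((1 - E) X) γ₂`. -/
noncomputable def testAndPrepare (E : Matrix (Fin d) (Fin d) ℂ)
    (γ₁ γ₂ : Matrix (Fin d') (Fin d') ℂ) :
    Matrix (Fin d) (Fin d) ℂ →ₗ[ℂ] Matrix (Fin d') (Fin d') ℂ where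
  toFun X := (E * X).trace • γ₁ + ((1 - E) * X).trace • γ₂
  map_add' X Y := by
    simp only [Matrix.mul_add, trace_add, add_smul]
    abel
  map_smul' c X := by
    simp only [Matrix.mul_smul, trace_smul, smul_add, smul_smul, smul_eq_mul, RingHom.id_apply]

/-- Factoring E = F·F writes the weighted partial trace as a sum of congruences of M. Complete
positivity follows, since the ampliation is a sum of Kronecker products of such matrices with
states. -/
theorem posSemidef_partial_trace {E : Matrix (Fin d) (Fin d) ℂ} (hE : E.PosSemidef) {k : ℕ}
    {M : Matrix (Fin k × Fin d) (Fin k × Fin d) ℂ} (hM : M.PosSemidef) :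
    (Matrix.of fun a b : Fin k =>
      (E * Matrix.of fun i j => M (a, i) (b, j)).trace).PosSemidef := by
  set F := E ^ (1 / 2 : ℝ) with hF
  have hFF : F * F = E :=
    rpow_mul_rpow_eq_self hE (by norm_num) (by norm_num) (by norm_num)
  let W : Fin d → Matrix (Fin k × Fin d) (Fin k) ℂ :=
    fun l => Matrix.of fun p b => if p.1 = b then F p.2 l else 0
  have e : (Matrix.of fun a b : Fin k => (E * Matrix.of fun i j => M (a, i) (b, j)).trace) =
      ∑ l, (W l)ᴴ * M * W l := by
    ext a b
    have h1 : ∀ l, ((W l)ᴴ * M * W l) a b =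
        (Fᴴ * (Matrix.of fun i j => M (a, i) (b, j)) * F) l l := by
      intro l
      simp only [Matrix.mul_apply, W, Fintype.sum_prod_type, conjTranspose_apply, of_apply,
        apply_ite star, star_zero, ite_mul, mul_ite, zero_mul, mul_zero]
      rw [Finset.sum_comm]
      simp
    rw [Matrix.sum_apply, Finset.sum_congr rfl fun l _ => h1 l, of_apply, ← hFF,
      hF, rpow_conjTranspose, ← hF, Matrix.mul_assoc, trace_mul_comm]
    rfl
  rw [e]
  exact posSemidef_sum _ fun l _ => hM.conjTranspose_mul_mul_same (W l)

theorem testAndPrepare_isChannel {E : Matrix (Fin d) (Fin d) ℂ}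
    {γ₁ γ₂ : Matrix (Fin d') (Fin d') ℂ} (hE : E.PosSemidef) (hE1 : (1 - E).PosSemidef)
    (h₁ : IsState γ₁) (h₂ : IsState γ₂) : IsChannel (testAndPrepare E γ₁ γ₂) := by
  refine ⟨fun k M hM => ?_, fun X => ?_⟩
  · exact ((posSemidef_partial_trace hE hM).kronecker h₁.1).add
      ((posSemidef_partial_trace hE1 hM).kronecker h₂.1)
  · change ((E * X).trace • γ₁ + ((1 - E) * X).trace • γ₂).trace = X.trace
    rw [trace_add, trace_smul, trace_smul, h₁.2, h₂.2, smul_eq_mul, smul_eq_mul, mul_one, mul_one,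
      ← trace_add, ← Matrix.add_mul, add_sub_cancel, Matrix.one_mul]

theorem testAndPrepare_isTestAndPrepare {E : Matrix (Fin d) (Fin d) ℂ}
    {γ₁ γ₂ : Matrix (Fin d') (Fin d') ℂ} (hE : E.PosSemidef) (hE1 : (1 - E).PosSemidef)
    (h₁ : IsState γ₁) (h₂ : IsState γ₂) : IsTestAndPrepare (testAndPrepare E γ₁ γ₂) :=
  ⟨γ₁, γ₂, E, h₁, h₂, hE, hE1, fun _ => rfl⟩

/-- Trace distance and purified distance are controlled by the best distinguishing projection. -/
theorem distances_le {ω ρ : Matrix (Fin d) (Fin d) ℂ} (hω : IsState ω) (hρ : IsState ρ) {x : ℝ}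
    (h : ∀ P : Matrix (Fin d) (Fin d) ℂ, P.PosSemidef → (1 - P).PosSemidef → P * P = P →
      (P * (ω - ρ)).trace.re ≤ x) :
    traceDistance ω ρ ≤ x ∧ purifiedDistance ω ρ ≤ √(2 * x) := by
  obtain ⟨P, Δ, hP, hP1, hPP, hΔ, hΔH, hPH, hnorm⟩ :=
    exists_posPart (hω.1.isHermitian.sub hρ.1.isHermitian)
  have hx : Δ.trace.re ≤ x := by
    rw [← hPH]; exact h P hP hP1 hPP
  have htr : (ω - ρ).trace.re = 0 := by rw [trace_sub, hω.2, hρ.2, sub_self, Complex.zero_re]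
  refine ⟨?_, ?_⟩
  · rw [traceDistance, hnorm, htr]; linarith
  · refine Real.sqrt_le_sqrt ?_
    -- Audenaert at s = 1/2 bounds the root fidelity below by 1 - x; then 1 - (1 - x)² ≤ 2x.
    have h1 := trace_sub_le_trace_rpow_mul_rpow hω.1 hρ.1 hΔ hΔH (s := 1 / 2)
      (by norm_num) (by norm_num)
    have h2 := trace_re_le_schattenOneNorm (CFC.sqrt ω * CFC.sqrt ρ)
    rw [CFC.sqrt_eq_rpow, CFC.sqrt_eq_rpow] at h2
    rw [show (1 - 1 / 2 : ℝ) = 1 / 2 by norm_num, hω.2, Complex.one_re] at h1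
    have h3 : 1 - x ≤ schattenOneNorm (ω ^ (1 / 2 : ℝ) * ρ ^ (1 / 2 : ℝ)) := by linarith
    rw [fidelity, CFC.sqrt_eq_rpow, CFC.sqrt_eq_rpow]
    rcases le_total x 1 with hx1 | hx1
    · nlinarith [pow_le_pow_left₀ (sub_nonneg.mpr hx1) h3 2, sq_nonneg x]
    · nlinarith [sq_nonneg (schattenOneNorm (ω ^ (1 / 2 : ℝ) * ρ ^ (1 / 2 : ℝ)))]

theorem exists_channel {ρ₁ σ₁ E : Matrix (Fin d) (Fin d) ℂ} {ρ₂ σ₂ ω : Matrix (Fin d') (Fin d') ℂ}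
    (hρ₁ : IsState ρ₁) (hσ₁ : IsState σ₁) (hρ₂ : IsState ρ₂) (hσ₂ : IsState σ₂)
    (hE : E.PosSemidef) (hE1 : (1 - E).PosSemidef) (hω : IsState ω) {μ η : ℝ}
    (hμ : ((μ : ℂ) • σ₂ - ω).PosSemidef) (hq : (E * σ₁).trace.re < 1)
    (hqμ : (E * σ₁).trace.re * μ ≤ 1)
    (hη : ∀ P : Matrix (Fin d') (Fin d') ℂ, P.PosSemidef → (1 - P).PosSemidef → P * P = P →
        (P * (ω - ρ₂)).trace.re ≤ η) :
    ∃ Φ : Matrix (Fin d) (Fin d) ℂ →ₗ[ℂ] Matrix (Fin d') (Fin d') ℂ,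
      (IsChannel Φ ∧ IsTestAndPrepare Φ) ∧ Φ σ₁ = σ₂ ∧
      traceDistance (Φ ρ₁) ρ₂ ≤ ((1 - E) * ρ₁).trace.re + η ∧
      purifiedDistance (Φ ρ₁) ρ₂ ≤ √(2 * (((1 - E) * ρ₁).trace.re + η)) := by
  have hcompl : ∀ X : Matrix (Fin d) (Fin d) ℂ, IsState X →
      ((1 - E) * X).trace = 1 - (E * X).trace := fun X hX => by
    rw [Matrix.sub_mul, Matrix.one_mul, trace_sub, hX.2]
  have hqC := trace_mul_eq_ofReal hE.isHermitian hσ₁.1.isHermitian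
  have hεC := trace_mul_eq_ofReal hE1.isHermitian hρ₁.1.isHermitian
  have hq0 := trace_mul_nonneg hE hσ₁.1
  have hε0 := trace_mul_nonneg hE1 hρ₁.1
  set q := (E * σ₁).trace.re
  set ε := ((1 - E) * ρ₁).trace.re
  -- σ₂ - qω = q(μσ₂ - ω) + (1 - qμ)σ₂.
  have hpos : (σ₂ - (q : ℂ) • ω).PosSemidef := by
    have := (ofReal_smul_posSemidef hμ hq0).add
      (ofReal_smul_posSemidef hσ₂.1 (sub_nonneg.mpr hqμ))
    convert this using 1
    push_cast
    module
  have hq1 : (1 : ℂ) - q ≠ 0 := by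
    rw [← Complex.ofReal_one, ← Complex.ofReal_sub, Complex.ofReal_ne_zero]
    linarith
  set τ := (((1 - q)⁻¹ : ℝ) : ℂ) • (σ₂ - (q : ℂ) • ω) with hτ
  have hτs : IsState τ := by
    refine ⟨ofReal_smul_posSemidef hpos (inv_nonneg.mpr (by linarith)), ?_⟩
    rw [hτ, trace_smul, trace_sub, trace_smul, hσ₂.2, hω.2, smul_eq_mul, smul_eq_mul, mul_one]
    push_cast
    exact inv_mul_cancel₀ hq1
  have hΦρ : testAndPrepare E ω τ ρ₁ = ω + (ε : ℂ) • (τ - ω) := by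
    change (E * ρ₁).trace • ω + ((1 - E) * ρ₁).trace • τ = _
    have : (E * ρ₁).trace = 1 - (ε : ℂ) := by rw [← hεC, hcompl ρ₁ hρ₁]; ring
    rw [this, hεC]
    module
  have hch := testAndPrepare_isChannel hE hE1 hω hτs
  have htp := testAndPrepare_isTestAndPrepare hE hE1 hω hτs
  refine ⟨testAndPrepare E ω τ, ⟨hch, htp⟩, ?_, ?_⟩
  · change (E * σ₁).trace • ω + ((1 - E) * σ₁).trace • τ = σ₂
    rw [hcompl σ₁ hσ₁, hqC, hτ, smul_smul]
    push_cast
    rw [mul_inv_cancel₀ hq1, one_smul, add_sub_cancel]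
  · have hε1 : ε ≤ 1 := by
      have := trace_mul_nonneg hE hρ₁.1
      have h2 := congrArg Complex.re (hcompl ρ₁ hρ₁)
      rw [Complex.sub_re, Complex.one_re] at h2
      change ε = _ at h2
      linarith
    have hst : IsState (testAndPrepare E ω τ ρ₁) := by
      refine ⟨?_, (hch.2 ρ₁).trans hρ₁.2⟩
      have e : testAndPrepare E ω τ ρ₁ = ((1 - ε : ℝ) : ℂ) • ω + (ε : ℂ) • τ := by
        rw [hΦρ]; push_cast; module
      rw [e]
      exact (ofReal_smul_posSemidef hω.1 (by linarith)).add (ofReal_smul_posSemidef hτs.1 hε0)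
    refine distances_le hst hρ₂ fun P hP hP1 hPP => ?_
    have e : P * (testAndPrepare E ω τ ρ₁ - ρ₂) =
        P * (ω - ρ₂) + (P * ((ε : ℂ) • τ) - P * ((ε : ℂ) • ω)) := by
      rw [hΦρ, ← Matrix.mul_sub, ← Matrix.mul_add, smul_sub]
      congr 1
      abel
    rw [e, trace_add, trace_sub, Complex.add_re, Complex.sub_re, ofReal_smul_trace_mul ε P τ,
      ofReal_smul_trace_mul ε P ω]
    have h1 := hη P hP hP1 hPP
    have h2 := trace_mul_nonneg hP hω.1
    have h3 := trace_mul_le_trace hτs.1 hP1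
    rw [hτs.2, Complex.one_re] at h3
    nlinarith [mul_nonneg hε0 h2, mul_le_mul_of_nonneg_left h3 hε0]

/-! ### From divergence rates to one-shot errors. -/

theorem le_two_rpow_of_logb_le {Q y : ℝ} (hQ : 0 ≤ Q) (h : Real.logb 2 Q ≤ y) :
    Q ≤ (2 : ℝ) ^ y := by
  rcases hQ.eq_or_lt with h0 | h0
  · rw [← h0]; positivity
  · exact (Real.logb_le_iff_le_rpow (by norm_num) h0).mp h

theorem sandwiched_trace_nonneg (ρ σ : Matrix (Fin d) (Fin d) ℂ) (x α : ℝ) :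
    0 ≤ ((σ ^ x * ρ * σ ^ x) ^ α).trace.re :=
  (Complex.le_def.mp (rpow_posSemidef _ α).trace_nonneg).1

theorem sandwiched_trace_le_of_lt_sandwichedRenyi {ρ σ : Matrix (Fin d) (Fin d) ℂ} {α y : ℝ}
    (hα : α < 1) (h : y < sandwichedRenyi α ρ σ) :
    ((σ ^ ((1 - α) / (2 * α)) * ρ * σ ^ ((1 - α) / (2 * α))) ^ α).trace.re ≤
      (2 : ℝ) ^ ((α - 1) * y) := by
  rw [sandwichedRenyi, if_neg hα.ne] at h
  refine le_two_rpow_of_logb_le (sandwiched_trace_nonneg ρ σ _ α) ?_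
  have := mul_le_mul_of_nonpos_left h.le (by linarith : α - 1 ≤ 0)
  rwa [← mul_assoc, mul_one_div_cancel (by linarith), one_mul] at this

theorem sandwiched_trace_le_of_sandwichedRenyi_lt {ρ σ : Matrix (Fin d) (Fin d) ℂ} {α y : ℝ}
    (hα : 1 < α) (h : sandwichedRenyi α ρ σ < y) :
    ((σ ^ ((1 - α) / (2 * α)) * ρ * σ ^ ((1 - α) / (2 * α))) ^ α).trace.re ≤
      (2 : ℝ) ^ ((α - 1) * y) := by
  rw [sandwichedRenyi, if_neg hα.ne'] at h
  refine le_two_rpow_of_logb_le (sandwiched_trace_nonneg ρ σ _ α) ?_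
  have := mul_le_mul_of_nonneg_left h.le (by linarith : 0 ≤ α - 1)
  rwa [← mul_assoc, mul_one_div_cancel (by linarith), one_mul] at this

/-- Continuity at 1 carries the strict bound to nearby orders, and convergence at each fixed order
then carries it to large n; the threshold on n may depend on α. -/
theorem eventually_lt_sandwichedRenyi {d : ℕ → ℕ}
    {ρ σ : (n : ℕ) → Matrix (Fin (d n)) (Fin (d n)) ℂ} (h : RegularizedRenyiCondition ρ σ) {c : ℝ}
    (hc : (c : EReal) < regularizedRenyi ρ σ 1) :
    ∀ᶠ α in 𝓝 (1 : ℝ), ∀ᶠ n : ℕ in atTop, c * n < sandwichedRenyi α (ρ n) (σ n) := by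
  filter_upwards [h.1, h.2.eventually_const_lt hc] with α ⟨l, hl⟩ hα
  rw [regularizedRenyi, hl.limUnder_eq] at hα
  filter_upwards [hl.eventually_const_lt hα, eventually_gt_atTop 0] with n hn hn0
  rw [renyiRate, EReal.coe_lt_coe_iff] at hn
  have : (0 : ℝ) < n := by exact_mod_cast hn0
  rwa [one_div_mul_eq_div, lt_div_iff₀ this] at hn

theorem eventually_sandwichedRenyi_lt {d : ℕ → ℕ}
    {ρ σ : (n : ℕ) → Matrix (Fin (d n)) (Fin (d n)) ℂ} (h : RegularizedRenyiCondition ρ σ) {c : ℝ}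
    (hc : regularizedRenyi ρ σ 1 < (c : EReal)) :
    ∀ᶠ α in 𝓝 (1 : ℝ), ∀ᶠ n : ℕ in atTop, sandwichedRenyi α (ρ n) (σ n) < c * n := by
  filter_upwards [h.1, h.2.eventually_lt_const hc] with α ⟨l, hl⟩ hα
  rw [regularizedRenyi, hl.limUnder_eq] at hα
  filter_upwards [hl.eventually_lt_const hα, eventually_gt_atTop 0] with n hn hn0
  rw [renyiRate, EReal.coe_lt_coe_iff] at hn
  have : (0 : ℝ) < n := by exact_mod_cast hn0
  rwa [one_div_mul_eq_div, div_lt_iff₀ this] at hn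

/-- A one-shot form of the achievability statement. -/
theorem exists_channel_of_sandwichedRenyi {ρ₁ σ₁ : Matrix (Fin d) (Fin d) ℂ}
    {ρ₂ σ₂ : Matrix (Fin d') (Fin d') ℂ} (hρ₁ : IsState ρ₁) (hσ₁ : IsState σ₁) (hρ₂ : IsState ρ₂)
    (hσ₂ : IsState σ₂) (hσ₂' : σ₂.PosDef) {b α : ℝ} (hb : 0 < b) (hb' : b < 1 / 2)
    (hα : α * (1 + 2 * b) = 1) {k : ℕ} (hk : 2 ≤ k) {β : ℝ} (hβ : β * (1 - 1 / k) = 1)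
    {u v w z : ℝ} (h₁ : w < sandwichedRenyi α ρ₁ σ₁) (h₂ : sandwichedRenyi β ρ₂ σ₂ < u)
    (huv : u ≤ v) (hz1 : 2 * (2 : ℝ) ^ (-z) ≤ 1) (hzw : z ≤ b * (w - v))
    (hzu : 2 * z ≤ (β - 1) * (v - u)) :
    ∃ Φ : Matrix (Fin d) (Fin d) ℂ →ₗ[ℂ] Matrix (Fin d') (Fin d') ℂ,
      (IsChannel Φ ∧ IsTestAndPrepare Φ) ∧ Φ σ₁ = σ₂ ∧
      traceDistance (Φ ρ₁) ρ₂ ≤ 8 * (2 : ℝ) ^ (-z) ∧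
      purifiedDistance (Φ ρ₁) ρ₂ ≤ 4 * (2 : ℝ) ^ (-(z / 2)) := by
  have hk2 : (2 : ℝ) ≤ k := by exact_mod_cast hk
  have hk1 : (1 : ℝ) / k ≤ 1 / 2 := by
    apply one_div_le_one_div_of_le <;> linarith
  have hk0 : (0 : ℝ) < 1 / k := by positivity
  have hα0 : 0 < α := by
    by_contra hneg
    nlinarith
  have hα1 : α < 1 := by nlinarith
  have hβ0 : 0 < β := by
    by_contra hneg
    nlinarith
  have hβ1 : 1 < β := by nlinarith
  have heα : (1 - α) / (2 * α) = b := by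
    rw [div_eq_iff (by positivity)]; linear_combination -hα
  have heβ : (1 - β) / (2 * β) = -(1 / (2 * k)) := by
    rw [div_eq_iff (by positivity)]
    field_simp at hβ ⊢
    linear_combination -hβ
  have hQ₁ := sandwiched_trace_le_of_lt_sandwichedRenyi hα1 h₁
  have hQ₂ := sandwiched_trace_le_of_sandwichedRenyi_lt hβ1 h₂
  rw [heα] at hQ₁
  rw [heβ] at hQ₂
  have hu : 0 ≤ u := by
    have h := (one_le_sandwiched hρ₂ hσ₂ hσ₂' hk hβ).trans hQ₂
    by_contra hneg
    exact absurd h (not_le.mpr (Real.rpow_lt_one_of_one_lt_of_neg (by norm_num)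
      (mul_neg_of_pos_of_neg (by linarith) (not_le.mp hneg))))
  -- One threshold serves both the test and the smoothing; this is what couples the two pairs.
  set t : ℝ := (2 : ℝ) ^ v with ht
  have ht1 : 1 ≤ t := Real.one_le_rpow (by norm_num) (hu.trans huv)
  obtain ⟨E, hE, hE1, hEt⟩ := exists_test hρ₁ hσ₁.1 hb hb' hα (zero_le_one.trans ht1)
  obtain ⟨Δ, hΔ, hΔH, hΔt⟩ := exists_posPart_trace_le hρ₂ hσ₂' hk hβ (zero_lt_one.trans_le ht1)
  obtain ⟨ω, hω, hωσ, hωP⟩ := exists_smoothing hρ₂ hσ₂ hσ₂' (zero_lt_one.trans_le ht1) hΔ hΔH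
  have hs : ((1 - E) * ρ₁).trace.re + t * (E * σ₁).trace.re ≤ (2 : ℝ) ^ (-z) := by
    refine hEt.trans ?_
    calc _ ≤ t ^ b * ((2 : ℝ) ^ ((α - 1) * w)) ^ (1 / 2 + b) := by
          refine mul_le_mul_of_nonneg_left ?_ (by positivity)
          exact Real.rpow_le_rpow (sandwiched_trace_nonneg _ _ _ _) hQ₁ (by linarith)
      _ = (2 : ℝ) ^ (-(b * (w - v))) := by
          rw [ht, ← Real.rpow_mul (by norm_num), ← Real.rpow_mul (by norm_num),
            ← Real.rpow_add (by norm_num)]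
          congr 1
          linear_combination (w / 2) * hα
      _ ≤ _ := Real.rpow_le_rpow_of_exponent_le (by norm_num) (by linarith)
  have hδ : Δ.trace.re ≤ ((2 : ℝ) ^ (-z)) ^ 2 := by
    refine hΔt.trans ?_
    calc _ ≤ t ^ (1 - β) * (2 : ℝ) ^ ((β - 1) * u) :=
          mul_le_mul_of_nonneg_left hQ₂ (by positivity)
      _ = (2 : ℝ) ^ (-((β - 1) * (v - u))) := by
          rw [ht, ← Real.rpow_mul (by norm_num), ← Real.rpow_add (by norm_num)]
          congr 1
          ring
      _ ≤ (2 : ℝ) ^ (-z * (2 : ℕ)) :=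
          Real.rpow_le_rpow_of_exponent_le (by norm_num) (by push_cast; linarith)
      _ = _ := Real.rpow_mul_natCast (by norm_num) _ _
  have hε0 := trace_mul_nonneg hE1 hρ₁.1
  have hq0 := trace_mul_nonneg hE hσ₁.1
  have hqt : (E * σ₁).trace.re ≤ t * (E * σ₁).trace.re := le_mul_of_one_le_left hq0 ht1
  -- Here q ≤ tq ≤ 2^(-z) ≤ 1/2, so q < 1 and q(t + 1) ≤ 2·2^(-z) ≤ 1.
  obtain ⟨Φ, hΦ, hΦσ, hT, hP⟩ := exists_channel hρ₁ hσ₁ hρ₂ hσ₂ hE hE1 hω hωσ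
    (by linarith) (by rw [mul_add, mul_one, mul_comm]; linarith) hωP
  set s : ℝ := (2 : ℝ) ^ (-z) with hsdef
  have hs0 : 0 < s := by positivity
  -- √2 ≤ 3/2, so the total error is at most s + 4·(3/2)s = 7s.
  have hη : √(2 * Δ.trace.re) ≤ 3 / 2 * s := by
    rw [Real.sqrt_le_left (by positivity)]
    nlinarith
  have hx : ((1 - E) * ρ₁).trace.re + 4 * √(2 * Δ.trace.re) ≤ 8 * s := by
    have : 0 ≤ t * (E * σ₁).trace.re := by positivity
    linarith
  refine ⟨Φ, hΦ, hΦσ, hT.trans hx, hP.trans ?_⟩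
  rw [Real.sqrt_le_left (by positivity), mul_pow, ← Real.rpow_mul_natCast (by norm_num)]
  rw [show -(z / 2) * ((2 : ℕ) : ℝ) = -z by push_cast; ring]
  linarith

end QDichotomy

/-! ### The asymptotic theorem. -/

theorem mainTheorem2 (d₁ d₂ : ℕ → ℕ)
    (ρ₁ σ₁ : (n : ℕ) → Matrix (Fin (d₁ n)) (Fin (d₁ n)) ℂ)
    (ρ₂ σ₂ : (n : ℕ) → Matrix (Fin (d₂ n)) (Fin (d₂ n)) ℂ)
    (hρ₁ : ∀ n, QDichotomy.IsState (ρ₁ n)) (hσ₁ : ∀ n, QDichotomy.IsState (σ₁ n))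
    (hρ₂ : ∀ n, QDichotomy.IsState (ρ₂ n)) (hσ₂ : ∀ n, QDichotomy.IsState (σ₂ n))
    (hσ₁' : ∀ n, (σ₁ n).PosDef) (hσ₂' : ∀ n, (σ₂ n).PosDef)
    (h₁ : QDichotomy.RegularizedRenyiCondition ρ₁ σ₁)
    (h₂ : QDichotomy.RegularizedRenyiCondition ρ₂ σ₂)
    (hlt : QDichotomy.regularizedRenyi ρ₁ σ₁ 1 > QDichotomy.regularizedRenyi ρ₂ σ₂ 1) :
    ∃ γ : ℝ, 0 < γ ∧ ∃ n₀ : ℕ,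
      ∃ Φ : (n : ℕ) → Matrix (Fin (d₁ n)) (Fin (d₁ n)) ℂ →ₗ[ℂ] Matrix (Fin (d₂ n)) (Fin (d₂ n)) ℂ,
        (∀ n, QDichotomy.IsChannel (Φ n) ∧ QDichotomy.IsTestAndPrepare (Φ n)) ∧
        (∀ n, Φ n (σ₁ n) = σ₂ n) ∧
        ∀ n ≥ n₀,
          QDichotomy.traceDistance (Φ n (ρ₁ n)) (ρ₂ n) ≤ (2 : ℝ) ^ (-γ * (n : ℝ)) ∧
          QDichotomy.purifiedDistance (Φ n (ρ₁ n)) (ρ₂ n) ≤ (2 : ℝ) ^ (-γ * (n : ℝ)) := by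
  obtain ⟨v, hv₂, hv₁⟩ := EReal.lt_iff_exists_real_btwn.mp hlt
  obtain ⟨u, hu₂, huv⟩ := EReal.lt_iff_exists_real_btwn.mp hv₂
  obtain ⟨w, hvw, hw₁⟩ := EReal.lt_iff_exists_real_btwn.mp hv₁
  rw [EReal.coe_lt_coe_iff] at huv hvw
  -- The order 1/(1 + 2b) tends to 1 from below as b → 0⁺; similarly k/(k - 1) tends to 1 from above
  -- as k → ∞.
  obtain ⟨b, ⟨hb, hb'⟩, hα⟩ : ∃ b : ℝ, (0 < b ∧ b < 1 / 2) ∧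
      ∀ᶠ n : ℕ in atTop, w * n < QDichotomy.sandwichedRenyi (1 + 2 * b)⁻¹ (ρ₁ n) (σ₁ n) := by
    have ht : Tendsto (fun b : ℝ => (1 + 2 * b)⁻¹) (𝓝[>] 0) (𝓝 1) := by
      have : ContinuousAt (fun b : ℝ => (1 + 2 * b)⁻¹) 0 :=
        ContinuousAt.inv₀ (by fun_prop) (by norm_num)
      simpa using this.tendsto.mono_left nhdsWithin_le_nhds
    exact ((eventually_mem_nhdsWithin.and
      (eventually_nhdsWithin_of_eventually_nhds (eventually_lt_nhds (by norm_num)))).and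
      (ht.eventually (QDichotomy.eventually_lt_sandwichedRenyi h₁ hw₁))).exists
  obtain ⟨k, hk, hβ⟩ : ∃ k : ℕ, 2 ≤ k ∧
      ∀ᶠ n : ℕ in atTop, QDichotomy.sandwichedRenyi (1 - 1 / (k : ℝ))⁻¹ (ρ₂ n) (σ₂ n) < u * n := by
    have ht : Tendsto (fun k : ℕ => (1 - 1 / (k : ℝ))⁻¹) atTop (𝓝 1) := by
      have : Tendsto (fun k : ℕ => (1 - 1 / (k : ℝ))) atTop (𝓝 (1 - 0)) :=
        tendsto_const_nhds.sub tendsto_one_div_atTop_nhds_zero_nat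
      simpa using this.inv₀ (by norm_num)
    exact ((eventually_ge_atTop 2).and
      (ht.eventually (QDichotomy.eventually_sandwichedRenyi_lt h₂ hu₂))).exists
  have hk2 : (2 : ℝ) ≤ k := by exact_mod_cast hk
  have hk1 : (1 : ℝ) / k ≤ 1 / 2 := by
    apply one_div_le_one_div_of_le <;> linarith
  have hk0 : (0 : ℝ) < 1 / k := by positivity
  set α := (1 + 2 * b)⁻¹
  set β := (1 - 1 / (k : ℝ))⁻¹
  have hα1 : α * (1 + 2 * b) = 1 := inv_mul_cancel₀ (by linarith)
  have hβ1 : β * (1 - 1 / k) = 1 := inv_mul_cancel₀ (by linarith)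
  have hβ2 : 1 < β := (one_lt_inv₀ (by linarith)).mpr (by linarith)
  obtain ⟨g, hg, hgw, hgu⟩ : ∃ g : ℝ, 0 < g ∧ g ≤ b * (w - v) ∧ 2 * g ≤ (β - 1) * (v - u) := by
    have p1 : 0 < b * (w - v) := mul_pos hb (sub_pos.mpr hvw)
    have p2 : 0 < (β - 1) * (v - u) := mul_pos (sub_pos.mpr hβ2) (sub_pos.mpr huv)
    refine ⟨min (b * (w - v)) ((β - 1) * (v - u) / 2), lt_min p1 (by linarith),
      min_le_left _ _, ?_⟩
    linarith [min_le_right (b * (w - v)) ((β - 1) * (v - u) / 2)]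
  -- With s = 2^(-gn/4), the one-shot bounds are 8s⁴ and 4s²; both are at most s once s ≤ 1/8, so
  -- the rate g/4 absorbs the constants.
  have hbig : ∀ᶠ n : ℕ in atTop, (2 : ℝ) ^ (-(g / 4 * n)) ≤ 1 / 8 := by
    have ht : Tendsto (fun n : ℕ => (2 : ℝ) ^ (-(g / 4 * n))) atTop (𝓝 0) := by
      refine (tendsto_rpow_atBot_of_base_gt_one 2 (by norm_num)).comp ?_
      exact tendsto_neg_atTop_atBot.comp
        (tendsto_natCast_atTop_atTop.const_mul_atTop (by linarith))
    exact (ht.eventually_lt_const (by norm_num)).mono fun n hn => hn.le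
  have hmain : ∀ᶠ n : ℕ in atTop,
      ∃ Φ : Matrix (Fin (d₁ n)) (Fin (d₁ n)) ℂ →ₗ[ℂ] Matrix (Fin (d₂ n)) (Fin (d₂ n)) ℂ,
        (QDichotomy.IsChannel Φ ∧ QDichotomy.IsTestAndPrepare Φ) ∧ Φ (σ₁ n) = σ₂ n ∧
        QDichotomy.traceDistance (Φ (ρ₁ n)) (ρ₂ n) ≤ (2 : ℝ) ^ (-(g / 4) * (n : ℝ)) ∧
        QDichotomy.purifiedDistance (Φ (ρ₁ n)) (ρ₂ n) ≤ (2 : ℝ) ^ (-(g / 4) * (n : ℝ)) := by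
    filter_upwards [hα, hβ, hbig] with n h1 h2 h3
    have hn : (0 : ℝ) ≤ n := n.cast_nonneg
    set s : ℝ := (2 : ℝ) ^ (-(g / 4) * (n : ℝ)) with hs
    have hs0 : 0 < s := by positivity
    have hs1 : s ≤ 1 / 8 := by rwa [hs, neg_mul]
    have e2 : (2 : ℝ) ^ (-(g * n / 2)) = s ^ 2 := by
      rw [hs, ← Real.rpow_mul_natCast (by norm_num)]
      congr 1
      push_cast
      ring
    have e4 : (2 : ℝ) ^ (-(g * n)) = s ^ 4 := by
      rw [hs, ← Real.rpow_mul_natCast (by norm_num)]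
      congr 1
      push_cast
      ring
    have p2 : s ^ 2 ≤ 1 / 8 * s := by nlinarith
    have p4 : s ^ 4 ≤ 1 / 8 * s := by nlinarith
    obtain ⟨Φ, hΦ, hΦσ, hT, hP⟩ := QDichotomy.exists_channel_of_sandwichedRenyi (hρ₁ n) (hσ₁ n)
      (hρ₂ n) (hσ₂ n) (hσ₂' n) hb hb' hα1 hk hβ1 h1 h2 (v := v * n) (z := g * n)
      (mul_le_mul_of_nonneg_right huv.le hn) (by rw [e4]; linarith)
      (by nlinarith [mul_le_mul_of_nonneg_right hgw hn])
      (by nlinarith [mul_le_mul_of_nonneg_right hgu hn])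
    rw [e4] at hT
    rw [e2] at hP
    exact ⟨Φ, hΦ, hΦσ, by linarith, by linarith⟩
  obtain ⟨n₀, hn₀⟩ := eventually_atTop.mp hmain
  refine ⟨g / 4, by linarith, n₀, ?_⟩
  have hall : ∀ n : ℕ,
      ∃ Φ : Matrix (Fin (d₁ n)) (Fin (d₁ n)) ℂ →ₗ[ℂ] Matrix (Fin (d₂ n)) (Fin (d₂ n)) ℂ,
        (QDichotomy.IsChannel Φ ∧ QDichotomy.IsTestAndPrepare Φ) ∧ Φ (σ₁ n) = σ₂ n ∧
        (n₀ ≤ n →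
          QDichotomy.traceDistance (Φ (ρ₁ n)) (ρ₂ n) ≤ (2 : ℝ) ^ (-(g / 4) * (n : ℝ)) ∧
          QDichotomy.purifiedDistance (Φ (ρ₁ n)) (ρ₂ n) ≤ (2 : ℝ) ^ (-(g / 4) * (n : ℝ))) := by
    intro n
    by_cases hn : n₀ ≤ n
    · obtain ⟨Φ, hΦ, hΦσ, hd⟩ := hn₀ n hn
      exact ⟨Φ, hΦ, hΦσ, fun _ => hd⟩
    -- For small n only exactness on σ₁ is needed, so the channel with constant output σ₂ on states
    -- serves.
    · have hE1 : (1 - 1 : Matrix (Fin (d₁ n)) (Fin (d₁ n)) ℂ).PosSemidef := by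
        simpa using Matrix.PosSemidef.zero
      refine ⟨QDichotomy.testAndPrepare 1 (σ₂ n) (σ₂ n),
        ⟨QDichotomy.testAndPrepare_isChannel Matrix.PosSemidef.one hE1 (hσ₂ n) (hσ₂ n),
        QDichotomy.testAndPrepare_isTestAndPrepare Matrix.PosSemidef.one hE1 (hσ₂ n) (hσ₂ n)⟩,
        ?_, fun h => absurd h hn⟩
      simp [QDichotomy.testAndPrepare, (hσ₁ n).2]
  choose Φ hΦ hΦσ hd using hall
  exact ⟨Φ, hΦ, hΦσ, fun n hn => hd n hn⟩
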